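/- Let $\tau(z,w)=(\bar z,\bar w)$ be complex conjugation on $\mathbb C^2$. A $C^\infty$ hypersurface in $\mathbb C^2$ is an embedded real $C^\infty$ submanifold of codimension $1$ (without boundary, not necessarily closed). It is Levi-flat if its complex tangent bundle $T^cS=TS\cap J(TS)$ is involutive, where $J$ is multiplication by $i$. A set $H\subset\mathbb C^2$ is a $C^\infty$ hypersurface with boundary $\partial H\subset H$ if $H\setminus\partial H$ is a $C^\infty$ hypersurface and every $p\in\partial H$ has an open neighbourhood $W$ with a $C^\infty$ diffeomorphism $\varphi\colon W\to\mathbb R^4$ such that $\varphi(H\cap W)=\{x_3\ge 0,\ x_4=0\}$ and $\varphi(\partial H\cap W)=\{x_3=0,\ x_4=0\}$; it is called Levi-flat if $H\setminus\partial H$ is Levi-flat. **Theorem.** Let $H\subset\mathbb C^2$ be a Levi-flat $C^\infty$ hypersurface with boundary such that $0\in\partial H\subset\mathbb R^2$. Then there is an open neighbourhood $U\subset\mathbb C^2$ of $0$ with $U=\tau(U)$ such that $(H\cap U)\cup\tau(H\cap U)$ is a $C^\infty$ Levi-flat hypersurface (without boundary). -/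

import Mathlib

open scoped ContDiff Topology

/-- A `C^∞` diffeomorphism from the open set `e.source` of `ℂ²` onto the open set `e.target`
of `ℝ⁴` (smoothness is in the real sense). -/
def IsSmoothDiffeo (e : OpenPartialHomeomorph (ℂ × ℂ) (Fin 4 → ℝ)) : Prop :=
  ContDiffOn ℝ ∞ e e.source ∧ ContDiffOn ℝ ∞ e.symm e.target

/-- `S ⊆ ℂ²` is a `C^∞` (embedded real) hypersurface without boundary: near each of its points
it is straightened to `x₄ = 0` by a diffeomorphism onto an open subset of `ℝ⁴`. -/
def IsSmoothHypersurface (S : Set (ℂ × ℂ)) : Prop :=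
  ∀ p ∈ S, ∃ e : OpenPartialHomeomorph (ℂ × ℂ) (Fin 4 → ℝ),
    IsSmoothDiffeo e ∧ p ∈ e.source ∧ e '' (S ∩ e.source) = {x ∈ e.target | x 3 = 0}

/-- `H ⊆ ℂ²` is a `C^∞` hypersurface with boundary, whose boundary is `bH`. -/
structure IsSmoothHypersurfaceWithBoundary (H bH : Set (ℂ × ℂ)) : Prop where
  boundary_subset : bH ⊆ H
  interior_hypersurface : IsSmoothHypersurface (H \ bH)
  boundary_chart : ∀ p ∈ bH, ∃ e : OpenPartialHomeomorph (ℂ × ℂ) (Fin 4 → ℝ),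
    IsSmoothDiffeo e ∧ p ∈ e.source ∧ e.target = Set.univ ∧
    e '' (H ∩ e.source) = {x | 0 ≤ x 2 ∧ x 3 = 0} ∧
    e '' (bH ∩ e.source) = {x | x 2 = 0 ∧ x 3 = 0}

/-- The tangent space `T_p S` of a submanifold `S` of `ℂ²`: velocities at `p` of smooth curves
in `S`. -/
def tangentVectors (S : Set (ℂ × ℂ)) (p : ℂ × ℂ) : Set (ℂ × ℂ) :=
  {v | ∃ γ : ℝ → ℂ × ℂ, ContDiffAt ℝ ∞ γ 0 ∧ γ 0 = p ∧ (∀ᶠ t in 𝓝 (0 : ℝ), γ t ∈ S) ∧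
    deriv γ 0 = v}

/-- The complex tangent space `T^c_p S = J (T_p S) ∩ T_p S`, `J` being multiplication by `i`. -/
def complexTangentVectors (S : Set (ℂ × ℂ)) (p : ℂ × ℂ) : Set (ℂ × ℂ) :=
  (fun v => Complex.I • v) '' tangentVectors S p ∩ tangentVectors S p

/-- A smooth hypersurface `S` is Levi-flat if the bundle `T^c S` is involutive: the Lie bracket of
any two local sections is again a section. Local sections are given by smooth vector fields on open
sets of `ℂ²` whose restrictions to `S` take values in `T^c S`; on `S` their bracket depends only on
these restrictions. -/
def IsLeviFlat (S : Set (ℂ × ℂ)) : Prop :=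
  ∀ (V : Set (ℂ × ℂ)) (X Y : ℂ × ℂ → ℂ × ℂ), IsOpen V →
    ContDiffOn ℝ ∞ X V → ContDiffOn ℝ ∞ Y V →
    (∀ q ∈ S ∩ V, X q ∈ complexTangentVectors S q) →
    (∀ q ∈ S ∩ V, Y q ∈ complexTangentVectors S q) →
    ∀ q ∈ S ∩ V, VectorField.lieBracket ℝ X Y q ∈ complexTangentVectors S q

/-- Complex conjugation `τ(z, w) = (z̄, w̄)` on `ℂ²`. -/
def conjC2 (p : ℂ × ℂ) : ℂ × ℂ :=
  (starRingEnd ℂ p.1, starRingEnd ℂ p.2)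

/-- The totally real plane `ℝ² ⊆ ℂ²`. -/
def realPlane : Set (ℂ × ℂ) :=
  {p | p.1.im = 0 ∧ p.2.im = 0}

/-!
Write `H` near `0` as half of a graph `Im w = r (z, Re w)`, with `z = x + iy` and `u = Re w`. The
hypersurface is Levi-flat exactly when its complex tangent lines `dw = a dz` integrate to
holomorphic curves, and then the slope `a` is holomorphic along these curves. In real terms this
says `r_y = Re a + Im a * r_u` and `a_y = i (a_x + ā a_u)`: a first-order evolution system in `y`.

If the boundary lies in `ℝ²`, a real linear change of coordinates turns `H` into the side `0 ≤ y` of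
such a graph, with `r = 0` where `y = 0`. The conjugate graph solves the same system on the side
`y ≤ 0`, and both solutions have the same values `r = a = 0` at `y = 0`. Since the system determines
all `y`-derivatives from the values at `y = 0`, all jets of the two functions agree there, so that
they glue to a smooth function. The glued hypersurface is Levi-flat off `y = 0`, hence everywhere by
continuity.
-/

section Jets

variable {E F G : Type*} [NormedAddCommGroup E] [NormedSpace ℝ E] [NormedAddCommGroup F]
  [NormedSpace ℝ F] [NormedAddCommGroup G] [NormedSpace ℝ G]

/-- Equality of jets along a set: at every point of `A`, the functions `f` and `g` have the same
derivatives of all orders `< n`. The strict inequality makes `n = 0` void, so that inductions on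
`n` start for free. -/
def EqJetOn (A : Set E) (n : ℕ) (f g : E → F) : Prop :=
  ∀ k < n, Set.EqOn (iteratedFDeriv ℝ k f) (iteratedFDeriv ℝ k g) A

variable {A : Set E} {n : ℕ} {f g : E → F}

theorem fderiv_fderiv_apply_comm (hf : ContDiff ℝ ∞ f) (p v w : E) :
    fderiv ℝ (fun q => fderiv ℝ f q v) p w = fderiv ℝ (fun q => fderiv ℝ f q w) p v := by
  have hd : DifferentiableAt ℝ (fderiv ℝ f) p :=
    (hf.fderiv_right (m := ∞) (by simp)).differentiable (by simp) p
  have hsymm : IsSymmSndFDerivAt ℝ f p :=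
    hf.contDiffAt.isSymmSndFDerivAt (by simpa using ENat.LEInfty.out)
  simpa [fderiv_clm_apply hd] using hsymm.eq w v

theorem iteratedFDeriv_fderiv_apply (hf : ContDiff ℝ ∞ f) (v : E) (k : ℕ) :
    iteratedFDeriv ℝ k (fun q => fderiv ℝ f q v) =
      fun p => fderiv ℝ (iteratedFDeriv ℝ k f) p v := by
  have hd : ∀ k, Differentiable ℝ (iteratedFDeriv ℝ k f) := fun k =>
    hf.differentiable_iteratedFDeriv (mod_cast WithTop.coe_lt_top k)
  induction k with
  | zero =>
    ext p m
    rw [← fderiv_continuousMultilinear_apply_const_apply (hd 0 p)]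
    rfl
  | succ k ih =>
    have hk : ContDiff ℝ ∞ (iteratedFDeriv ℝ k f) := hf.iteratedFDeriv_right (by norm_cast)
    have hk' : Differentiable ℝ fun q => fderiv ℝ (iteratedFDeriv ℝ k f) q :=
      (hk.fderiv_right (m := ∞) (by simp)).differentiable (by simp)
    ext p m
    rw [iteratedFDeriv_succ_apply_left, ih, fderiv_fderiv_apply_comm hk,
      ← fderiv_continuousMultilinear_apply_const_apply (hd (k + 1) p),
      ← fderiv_continuousMultilinear_apply_const_apply ((hk' p).clm_apply (by fun_prop))]
    rfl

namespace EqJetOn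

theorem zero : EqJetOn A 0 f g := fun _ hk => absurd hk (Nat.not_lt_zero _)

theorem succ_iff :
    EqJetOn A (n + 1) f g ↔ Set.EqOn f g A ∧ EqJetOn A n (fderiv ℝ f) (fderiv ℝ g) := by
  have hzero : Set.EqOn (iteratedFDeriv ℝ 0 f) (iteratedFDeriv ℝ 0 g) A ↔ Set.EqOn f g A := by
    simp only [Set.EqOn, iteratedFDeriv_zero_eq_comp, Function.comp_apply,
      EmbeddingLike.apply_eq_iff_eq]
  have hsucc : ∀ k, Set.EqOn (iteratedFDeriv ℝ (k + 1) f) (iteratedFDeriv ℝ (k + 1) g) A ↔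
      Set.EqOn (iteratedFDeriv ℝ k (fderiv ℝ f)) (iteratedFDeriv ℝ k (fderiv ℝ g)) A := fun k => by
    simp only [Set.EqOn, iteratedFDeriv_succ_eq_comp_right, Function.comp_apply,
      EmbeddingLike.apply_eq_iff_eq]
  simp only [EqJetOn, Nat.forall_lt_succ_left, hzero, hsucc]

theorem prodMk {f₁ g₁ : E → F} {f₂ g₂ : E → G} (h₁ : EqJetOn A n f₁ g₁) (h₂ : EqJetOn A n f₂ g₂)
    (hf₁ : ContDiff ℝ ∞ f₁) (hg₁ : ContDiff ℝ ∞ g₁) (hf₂ : ContDiff ℝ ∞ f₂)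
    (hg₂ : ContDiff ℝ ∞ g₂) :
    EqJetOn A n (fun p => (f₁ p, f₂ p)) (fun p => (g₁ p, g₂ p)) := fun k hk p hp => by
  rw [iteratedFDeriv_prodMk hf₁.contDiffAt hf₂.contDiffAt (mod_cast le_top),
    iteratedFDeriv_prodMk hg₁.contDiffAt hg₂.contDiffAt (mod_cast le_top), h₁ k hk hp, h₂ k hk hp]

theorem comp_left {Φ : F → G} (hΦ : ContDiff ℝ ∞ Φ) (h : EqJetOn A n f g) (hf : ContDiff ℝ ∞ f)
    (hg : ContDiff ℝ ∞ g) : EqJetOn A n (Φ ∘ f) (Φ ∘ g) := fun k hk p hp => by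
  have h0 : f p = g p := by
    simpa using congrArg (fun L => L 0) (h 0 (Nat.zero_lt_of_lt hk) hp)
  rw [iteratedFDeriv_comp hΦ.contDiffAt hf.contDiffAt (mod_cast le_top),
    iteratedFDeriv_comp hΦ.contDiffAt hg.contDiffAt (mod_cast le_top), h0]
  refine Finset.sum_congr rfl fun c _ => congrArg _ (funext fun i => ?_)
  exact h _ ((c.partSize_le i).trans_lt hk) hp

theorem of_forall_clm_apply {L M : E → F →L[ℝ] G} (hL : ContDiff ℝ ∞ L) (hM : ContDiff ℝ ∞ M)
    (h : ∀ v, EqJetOn A n (fun p => L p v) (fun p => M p v)) : EqJetOn A n L M :=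
  fun k hk p hp => by
    ext m v
    rw [← iteratedFDeriv_clm_apply_const_apply hL (mod_cast le_top),
      ← iteratedFDeriv_clm_apply_const_apply hM (mod_cast le_top), h v k hk hp]

theorem of_eqOn {O : Set E} (hO : IsOpen O) (hA : A ⊆ closure O) (hf : ContDiff ℝ ∞ f)
    (hg : ContDiff ℝ ∞ g) (h : Set.EqOn f g O) : EqJetOn A n f g := fun k _ =>
  Set.EqOn.mono hA <| Set.EqOn.closure (fun _ hp =>
      ((h.eventuallyEq_of_mem (hO.mem_nhds hp)).iteratedFDeriv ℝ k).self_of_nhds)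
    (hf.continuous_iteratedFDeriv (mod_cast le_top))
    (hg.continuous_iteratedFDeriv (mod_cast le_top))

/-- Differentiating in a direction tangent to `A` costs no order of agreement on `A`. -/
theorem fderiv_apply {v : E} (hv : ∀ p ∈ A, ∀ᶠ t : ℝ in 𝓝 0, p + t • v ∈ A)
    (h : EqJetOn A n f g) (hf : ContDiff ℝ ∞ f) (hg : ContDiff ℝ ∞ g) :
    EqJetOn A n (fun p => fderiv ℝ f p v) (fun p => fderiv ℝ g p v) := fun k hk p hp => by
  rw [iteratedFDeriv_fderiv_apply hf, iteratedFDeriv_fderiv_apply hg]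
  have hline : ∀ {φ : E → F}, ContDiff ℝ ∞ φ →
      HasLineDerivAt ℝ (iteratedFDeriv ℝ k φ) (fderiv ℝ (iteratedFDeriv ℝ k φ) p v) p v :=
    fun hφ => ((hφ.differentiable_iteratedFDeriv
      (mod_cast WithTop.coe_lt_top k)) p).hasFDerivAt.hasLineDerivAt v
  refine HasDerivAt.unique (hline hf) (HasDerivAt.congr_of_eventuallyEq (hline hg) ?_)
  filter_upwards [hv p hp] with t ht using h k hk ht

theorem symm (h : EqJetOn A n f g) : EqJetOn A n g f := fun k hk => (h k hk).symm

theorem trans {h : E → F} (hfg : EqJetOn A n f g) (hgh : EqJetOn A n g h) : EqJetOn A n f h :=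
  fun k hk => (hfg k hk).trans (hgh k hk)

/-- Formal uniqueness in the Cauchy problem: the equation `∂ₑ f = Φ (f, tangential derivatives)`
determines the Taylor series of `f` along the hyperplane piece `A` from the values of `f` there. -/
theorem of_evolution {ℓ : E →L[ℝ] ℝ} {e : E} (he : ℓ e = 1)
    (hA : ∀ p ∈ A, ∀ v, ℓ v = 0 → ∀ᶠ t : ℝ in 𝓝 0, p + t • v ∈ A)
    {Φ : F × (ℓ.ker →L[ℝ] F) → F} (hΦ : ContDiff ℝ ∞ Φ) (hf : ContDiff ℝ ∞ f)
    (hg : ContDiff ℝ ∞ g)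
    (hfΦ : ∀ n, EqJetOn A n (fun p => fderiv ℝ f p e)
      (fun p => Φ (f p, (fderiv ℝ f p).comp ℓ.ker.subtypeL)))
    (hgΦ : ∀ n, EqJetOn A n (fun p => fderiv ℝ g p e)
      (fun p => Φ (g p, (fderiv ℝ g p).comp ℓ.ker.subtypeL)))
    (hfg : Set.EqOn f g A) (n : ℕ) : EqJetOn A n f g := by
  have hDf : ContDiff ℝ ∞ (fderiv ℝ f) := hf.fderiv_right (by simp)
  have hDg : ContDiff ℝ ∞ (fderiv ℝ g) := hg.fderiv_right (by simp)
  have hres : ∀ {φ : E → F}, ContDiff ℝ ∞ (fderiv ℝ φ) →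
      ContDiff ℝ ∞ fun p => (fderiv ℝ φ p).comp ℓ.ker.subtypeL := fun h =>
    h.clm_comp contDiff_const
  induction n with
  | zero => exact zero
  | succ n ih =>
    have htan : ∀ v, ℓ v = 0 →
        EqJetOn A n (fun p => fderiv ℝ f p v) (fun p => fderiv ℝ g p v) := fun v hv =>
      ih.fderiv_apply (fun p hp => hA p hp v hv) hf hg
    have hnormal : EqJetOn A n (fun p => fderiv ℝ f p e) (fun p => fderiv ℝ g p e) := by
      refine ((hfΦ n).trans ?_).trans (hgΦ n).symm
      refine (ih.prodMk (of_forall_clm_apply (hres hDf) (hres hDg) fun v => ?_) hf hg (hres hDf)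
        (hres hDg)).comp_left hΦ (hf.prodMk (hres hDf)) (hg.prodMk (hres hDg))
      exact htan v v.2
    refine succ_iff.2 ⟨hfg, of_forall_clm_apply hDf hDg fun v => ?_⟩
    have hsplit : ∀ (L : E →L[ℝ] F), L v =
        (ContinuousLinearMap.fst ℝ F F + ℓ v • ContinuousLinearMap.snd ℝ F F)
          (L (v - ℓ v • e), L e) := fun L => by simp
    simp only [hsplit (fderiv ℝ _ _)]
    exact ((htan (v - ℓ v • e) (by simp [he])).prodMk hnormal (hDf.clm_apply contDiff_const)
      (hDg.clm_apply contDiff_const) (hDf.clm_apply contDiff_const)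
      (hDg.clm_apply contDiff_const)).comp_left (ContinuousLinearMap.contDiff _)
      ((hDf.clm_apply contDiff_const).prodMk (hDf.clm_apply contDiff_const))
      ((hDg.clm_apply contDiff_const).prodMk (hDg.clm_apply contDiff_const))

end EqJetOn

theorem hasFDerivAt_piecewise {C : Set E} [∀ x, Decidable (x ∈ C)] {f' g' : E →L[ℝ] F} {p : E}
    (hf : HasFDerivAt f f' p) (hg : HasFDerivAt g g' p) (hfg : p ∈ frontier C → f p = g p)
    (hfg' : p ∈ frontier C → f' = g') :
    HasFDerivAt (C.piecewise f g) (if p ∈ C then f' else g') p := by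
  by_cases hp : p ∈ frontier C
  · have hval : C.piecewise f g p = f p := by
      by_cases h : p ∈ C <;> simp [h, hfg hp]
    rw [← hfg' hp, ite_self, ← hasFDerivWithinAt_univ, ← Set.union_compl_self C]
    refine HasFDerivWithinAt.union ?_ ?_
    · exact hf.hasFDerivWithinAt.congr (fun q hq => Set.piecewise_eq_of_mem C f g hq) hval
    · rw [hfg' hp]
      exact hg.hasFDerivWithinAt.congr (fun q hq => Set.piecewise_eq_of_notMem C f g hq)
        (hval.trans (hfg hp))
  by_cases hpC : p ∈ C
  · rw [if_pos hpC]
    have hC : C ∈ 𝓝 p := mem_interior_iff_mem_nhds.1 (by_contra fun h => hp ⟨subset_closure hpC, h⟩)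
    exact hf.congr_of_eventuallyEq
      (Filter.eventually_of_mem hC fun q hq => Set.piecewise_eq_of_mem C f g hq)
  · rw [if_neg hpC]
    have hC : Cᶜ ∈ 𝓝 p := mem_interior_iff_mem_nhds.1 <| by
      rw [interior_compl]
      exact fun h => hp ⟨h, fun h' => hpC (interior_subset h')⟩
    exact hg.congr_of_eventuallyEq
      (Filter.eventually_of_mem hC fun q hq => Set.piecewise_eq_of_notMem C f g hq)

theorem EqJetOn.contDiffOn_piecewise {B C : Set E} [∀ x, Decidable (x ∈ C)]
    (h : ∀ n, EqJetOn (B ∩ frontier C) n f g) (hf : ContDiff ℝ ∞ f) (hg : ContDiff ℝ ∞ g) :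
    ContDiffOn ℝ ∞ (C.piecewise f g) B := by
  have hder : ∀ {φ : E → F}, ContDiff ℝ ∞ φ → ∀ (m : ℕ) p, HasFDerivAt (iteratedFDeriv ℝ m φ)
      (iteratedFDeriv ℝ (m + 1) φ p).curryLeft p := fun hφ m p =>
    ((hφ.differentiable_iteratedFDeriv (mod_cast WithTop.coe_lt_top m)) p).hasFDerivAt
  have hcoeff : ∀ (m : ℕ) p, C.piecewise (ftaylorSeries ℝ f) (ftaylorSeries ℝ g) p m =
      C.piecewise (iteratedFDeriv ℝ m f) (iteratedFDeriv ℝ m g) p := fun m p => by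
    by_cases hp : p ∈ C <;> simp [hp, ftaylorSeries]
  have hT : HasFTaylorSeriesUpToOn ∞ (C.piecewise f g)
      (C.piecewise (ftaylorSeries ℝ f) (ftaylorSeries ℝ g)) B := by
    refine (hasFTaylorSeriesUpToOn_top_iff' le_rfl).2 ⟨fun p _ => ?_, fun m p hp => ?_⟩
    · by_cases hpC : p ∈ C <;> simp [hpC, ftaylorSeries]
    · simp only [hcoeff]
      refine (hasFDerivAt_piecewise (hder hf m p) (hder hg m p)
        (fun hpC => h (m + 1) m (by lia) ⟨hp, hpC⟩)
        fun hpC => by rw [h (m + 2) (m + 1) (by lia) ⟨hp, hpC⟩]).hasFDerivWithinAt.congr_fderiv ?_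
      by_cases hpC : p ∈ C <;> simp [hpC]
  exact hT.contDiffOn

end Jets

section Calculus

variable {E F : Type*} [NormedAddCommGroup E] [NormedSpace ℝ E] [NormedAddCommGroup F]
  [NormedSpace ℝ F]

theorem exists_contDiff_eventuallyEq [HasContDiffBump E] {f : E → F} {N : Set E} {x : E}
    (hN : IsOpen N) (hx : x ∈ N) (hf : ContDiffOn ℝ ∞ f N) :
    ∃ g : E → F, ContDiff ℝ ∞ g ∧ g =ᶠ[𝓝 x] f := by
  obtain ⟨ε, hε, hball⟩ := Metric.isOpen_iff.1 hN x hx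
  let χ : ContDiffBump x := ⟨ε / 3, ε / 2, by positivity, by linarith⟩
  have hχN : tsupport χ ⊆ N := by
    rw [χ.tsupport_eq]
    exact (Metric.closedBall_subset_ball (half_lt_self hε)).trans hball
  refine ⟨fun y => χ y • f y, contDiff_iff_contDiffAt.2 fun y => ?_, ?_⟩
  · by_cases hy : y ∈ tsupport χ
    · exact χ.contDiff.contDiffAt.smul (hf.contDiffAt (hN.mem_nhds (hχN hy)))
    · refine contDiffAt_const (c := (0 : F)).congr_of_eventuallyEq ?_
      filter_upwards [notMem_tsupport_iff_eventuallyEq.1 hy] with z hz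
      simp [hz]
  · filter_upwards [χ.eventuallyEq_one] with y hy
    simp [hy]

theorem exists_openPartialHomeomorph_contDiffOn_symm [CompleteSpace E] {f : E → F} {U : Set E}
    {a : E} (hf : ContDiffOn ℝ ∞ f U) (hU : IsOpen U) (ha : a ∈ U) {f' : E ≃L[ℝ] F}
    (hf' : HasFDerivAt f (f' : E →L[ℝ] F) a) :
    ∃ e : OpenPartialHomeomorph E F, a ∈ e.source ∧ e.source ⊆ U ∧ ⇑e = f ∧
      ContDiffOn ℝ ∞ e.symm e.target := by
  let V := U ∩ fderiv ℝ f ⁻¹' Set.range ((↑) : (E ≃L[ℝ] F) → E →L[ℝ] F)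
  have hV : IsOpen V := (hf.continuousOn_fderiv_of_isOpen hU (by simp)).isOpen_inter_preimage hU
    ContinuousLinearEquiv.isOpen
  have haV : a ∈ V := ⟨ha, f', hf'.fderiv.symm⟩
  have hfa := hf.contDiffAt (hU.mem_nhds ha)
  let e := (hfa.toOpenPartialHomeomorph f hf' (by simp)).restrOpen V hV
  refine ⟨e, ⟨hfa.mem_toOpenPartialHomeomorph_source hf' (by simp), haV⟩, fun p hp => hp.2.1, rfl,
    fun q hq => ?_⟩
  obtain ⟨hqU, f'', hf''⟩ := (e.map_target hq).2
  have hfq := hf.contDiffAt (hU.mem_nhds hqU)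
  refine (e.contDiffAt_symm hq (f₀' := f'') ?_ hfq).contDiffWithinAt
  rw [hf'']
  exact (hfq.differentiableAt (by simp)).hasFDerivAt

theorem eventually_nonneg_iff_of_hasStrictFDerivAt {σ : E → ℝ} {ℓ : E →L[ℝ] ℝ} {e : E}
    (hσ : HasStrictFDerivAt σ ℓ 0) (he : ℓ e = 1) (h0 : ∀ᶠ q in 𝓝 0, ℓ q = 0 → σ q = 0) :
    ∀ᶠ q in 𝓝 0, (0 ≤ σ q ↔ 0 ≤ ℓ q) := by
  have hproj : Filter.Tendsto (fun q => q - ℓ q • e) (𝓝 0) (𝓝 0) := by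
    have : Continuous fun q => q - ℓ q • e := by fun_prop
    simpa using this.tendsto 0
  have hpair : Filter.Tendsto (fun q => (q, q - ℓ q • e)) (𝓝 0) (𝓝 (0, 0)) :=
    Filter.tendsto_id.prodMk_nhds hproj
  have hdist : (fun q => q - (q - ℓ q • e)) =O[𝓝 0] ℓ :=
    .of_bound ‖e‖ (.of_forall fun q => by simp [norm_smul, mul_comm])
  have hσℓ : (fun q => σ q - σ (q - ℓ q • e) - ℓ q) =o[𝓝 0] ℓ :=
    ((hσ.isLittleO.comp_tendsto hpair).trans_isBigO hdist).congr_left fun q => by simp [he]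
  filter_upwards [hσℓ.bound one_half_pos, hproj.eventually h0] with q hq hq0
  rw [hq0 (by simp [he]), sub_zero, Real.norm_eq_abs, Real.norm_eq_abs] at hq
  grind

end Calculus

section LeviSlope

variable {r s : ℂ × ℝ → ℝ} {a b : ℂ × ℝ → ℂ} {p : ℂ × ℝ}

/-- The slope `a` of the complex tangent line `{(ζ, a * ζ)}` of the hypersurface
`Im w = r (z, Re w)`, at the point lying over `p`. -/
noncomputable def leviSlope (r : ℂ × ℝ → ℝ) (p : ℂ × ℝ) : ℂ :=
  (fderiv ℝ r p (Complex.I, 0) + Complex.I * fderiv ℝ r p (1, 0)) /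
    (1 - Complex.I * fderiv ℝ r p (0, 1))

/-- The equation satisfied by the slope `a` of a family of holomorphic curves `w = w(z)`, filling
`Im w = r (z, Re w)` and parametrized by `(z, Re w)`: along each curve `a = dw/dz` is a holomorphic
function of `z`. -/
def LeafwiseHolomorphicAt (a : ℂ × ℝ → ℂ) (p : ℂ × ℝ) : Prop :=
  ∀ ζ : ℂ, fderiv ℝ a p (ζ, (a p * ζ).re) = ζ * fderiv ℝ a p (1, (a p).re)

theorem one_sub_I_mul_ofReal_ne_zero (k : ℝ) : 1 - Complex.I * k ≠ 0 := fun h => by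
  simpa using congrArg Complex.re h

theorem eq_leviSlope_mul_iff {ζ η : ℂ} : η = leviSlope r p * ζ ↔
    η.im = fderiv ℝ r p (ζ, η.re) ∧
      (Complex.I * η).im = fderiv ℝ r p (Complex.I * ζ, (Complex.I * η).re) := by
  have hL : ∀ (ξ : ℂ) (t : ℝ), fderiv ℝ r p (ξ, t) = ξ.re * fderiv ℝ r p (1, 0) +
      ξ.im * fderiv ℝ r p (Complex.I, 0) + t * fderiv ℝ r p (0, 1) := fun ξ t => by
    have hξ : ((ξ, t) : ℂ × ℝ) = ξ.re • (1, 0) + ξ.im • (Complex.I, 0) + t • (0, 1) := by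
      ext <;> simp
    rw [hξ]
    simp only [map_add, map_smul, smul_eq_mul]
  rw [leviSlope, div_mul_eq_mul_div, eq_div_iff (one_sub_I_mul_ofReal_ne_zero _), Complex.ext_iff,
    hL ζ, hL (Complex.I * ζ), and_comm]
  simp only [Complex.mul_re, Complex.mul_im, Complex.sub_re, Complex.sub_im, Complex.add_re,
    Complex.add_im, Complex.I_re, Complex.I_im, Complex.one_re, Complex.one_im, Complex.ofReal_re,
    Complex.ofReal_im]
  constructor <;> rintro ⟨h₁, h₂⟩ <;> constructor <;> linarith

theorem fderiv_I_eq_leviSlope : fderiv ℝ r p (Complex.I, 0) =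
    (leviSlope r p).re + (leviSlope r p).im * fderiv ℝ r p (0, 1) := by
  have h := div_mul_cancel₀ (fderiv ℝ r p (Complex.I, 0) + Complex.I * fderiv ℝ r p (1, 0))
    (one_sub_I_mul_ofReal_ne_zero (fderiv ℝ r p (0, 1)))
  simpa [leviSlope] using (congrArg Complex.re h).symm

theorem contDiff_leviSlope (hr : ContDiff ℝ ∞ r) : ContDiff ℝ ∞ (leviSlope r) := by
  have hD : ∀ v, ContDiff ℝ ∞ fun p => (fderiv ℝ r p v : ℂ) := fun v =>
    Complex.ofRealCLM.contDiff.comp ((hr.fderiv_right (by simp)).clm_apply contDiff_const)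
  exact ((hD (Complex.I, 0)).add (contDiff_const.mul (hD (1, 0)))).mul
    ((contDiff_const.sub (contDiff_const.mul (hD (0, 1)))).inv
      fun _ => one_sub_I_mul_ofReal_ne_zero _)

theorem leviSlope_congr (h : r =ᶠ[𝓝 p] s) : leviSlope r =ᶠ[𝓝 p] leviSlope s := by
  filter_upwards [h.fderiv (𝕜 := ℝ)] with q hq
  simp only [leviSlope, hq]

namespace LeafwiseHolomorphicAt

theorem congr (ha : LeafwiseHolomorphicAt a p) (h : b =ᶠ[𝓝 p] a) : LeafwiseHolomorphicAt b p := by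
  rw [LeafwiseHolomorphicAt, h.fderiv_eq, h.self_of_nhds]
  exact ha

theorem fderiv_I (ha : LeafwiseHolomorphicAt a p) : fderiv ℝ a p (Complex.I, 0) =
    Complex.I * (fderiv ℝ a p (1, 0) + starRingEnd ℂ (a p) * fderiv ℝ a p (0, 1)) := by
  have hL : ∀ (ξ : ℂ) (t : ℝ), fderiv ℝ a p (ξ, t) =
      fderiv ℝ a p (ξ, 0) + t * fderiv ℝ a p (0, 1) := fun ξ t => by
    have hξ : ((ξ, t) : ℂ × ℝ) = (ξ, 0) + t • (0, 1) := by ext <;> simp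
    rw [hξ, map_add, map_smul, Complex.real_smul]
  have h := ha Complex.I
  rw [hL Complex.I, hL 1] at h
  have hconj : Complex.I * starRingEnd ℂ (a p) = Complex.I * (a p).re - (a p * Complex.I).re := by
    apply Complex.ext <;> simp
  linear_combination h - fderiv ℝ a p (0, 1) * hconj

theorem isClosed_setOf (ha : ContDiff ℝ ∞ a) : IsClosed {p | LeafwiseHolomorphicAt a p} := by
  have hac := ha.continuous
  have hDa := ha.continuous_fderiv (by simp)
  simp only [LeafwiseHolomorphicAt, Set.ofPred_forall]
  exact isClosed_iInter fun ζ => isClosed_eq (by fun_prop) (by fun_prop)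

end LeafwiseHolomorphicAt

end LeviSlope

section Reflection

variable {r R : ℂ × ℝ → ℝ} {p : ℂ × ℝ} {A B : Set (ℂ × ℝ)} {n : ℕ}

/-- The involution `(z, u) ↦ (z̄, u)` of `ℂ × ℝ` induced by complex conjugation of `ℂ²` on the
parameters `(z, Re w)`. -/
noncomputable def baseConj : (ℂ × ℝ) →L[ℝ] (ℂ × ℝ) :=
  (Complex.conjCLE : ℂ →L[ℝ] ℂ).prodMap (ContinuousLinearMap.id ℝ ℝ)

/-- The function whose graph `Im w = r (z, Re w)` is conjugate to that of `r`. -/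
noncomputable def schwarzReflect (r : ℂ × ℝ → ℝ) (p : ℂ × ℝ) : ℝ := -r (baseConj p)

/-- Schwarz reflection: the values of `r` where `0 ≤ Im z`, continued by `schwarzReflect r`. -/
noncomputable def schwarzExtension (r : ℂ × ℝ → ℝ) : ℂ × ℝ → ℝ :=
  {p | 0 ≤ p.1.im}.piecewise r (schwarzReflect r)

theorem schwarzExtension_of_nonneg (hp : 0 ≤ p.1.im) : schwarzExtension r p = r p :=
  Set.piecewise_eq_of_mem {p : ℂ × ℝ | 0 ≤ p.1.im} _ _ hp

theorem schwarzExtension_of_neg (hp : p.1.im < 0) : schwarzExtension r p = schwarzReflect r p :=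
  Set.piecewise_eq_of_notMem {p : ℂ × ℝ | 0 ≤ p.1.im} _ _ (not_le.2 hp)

theorem baseConj_apply (p : ℂ × ℝ) : baseConj p = (starRingEnd ℂ p.1, p.2) := rfl

theorem baseConj_eq_self (hp : p.1.im = 0) : baseConj p = p :=
  Prod.ext (Complex.conj_eq_iff_im.2 hp) rfl

theorem contDiff_schwarzReflect (hr : ContDiff ℝ ∞ r) : ContDiff ℝ ∞ (schwarzReflect r) :=
  (hr.comp baseConj.contDiff).neg

theorem leviSlope_schwarzReflect (hr : Differentiable ℝ r) (p : ℂ × ℝ) :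
    leviSlope (schwarzReflect r) p = starRingEnd ℂ (leviSlope r (baseConj p)) := by
  have hD : HasFDerivAt (schwarzReflect r) (-((fderiv ℝ r (baseConj p)).comp baseConj)) p :=
    ((hr _).hasFDerivAt.comp p baseConj.hasFDerivAt).neg
  have hI : ∀ q, fderiv ℝ r q (-Complex.I, 0) = -fderiv ℝ r q (Complex.I, 0) := fun q => by
    rw [← map_neg]
    simp
  simp [leviSlope, hD.fderiv, baseConj_apply, hI]

theorem LeafwiseHolomorphicAt.reflect (hr : ContDiff ℝ ∞ r)
    (h : LeafwiseHolomorphicAt (leviSlope r) (baseConj p)) :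
    LeafwiseHolomorphicAt (leviSlope (schwarzReflect r)) p := fun ζ => by
  have hD : HasFDerivAt (leviSlope (schwarzReflect r)) ((Complex.conjCLE : ℂ →L[ℝ] ℂ).comp
      ((fderiv ℝ (leviSlope r) (baseConj p)).comp baseConj)) p := by
    rw [funext (leviSlope_schwarzReflect (hr.differentiable (by simp)))]
    exact (Complex.conjCLE : ℂ →L[ℝ] ℂ).hasFDerivAt.comp p
      (((contDiff_leviSlope hr).differentiable (by simp) _).hasFDerivAt.comp p
        baseConj.hasFDerivAt)
  have hζ := congrArg (starRingEnd ℂ) (h (starRingEnd ℂ ζ))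
  rw [hD.fderiv, leviSlope_schwarzReflect (hr.differentiable (by simp))]
  simpa [baseConj_apply] using hζ

/-- The coordinate `Im z` on `ℂ × ℝ`. -/
noncomputable def imCoord : (ℂ × ℝ) →L[ℝ] ℝ := Complex.imCLM.comp (ContinuousLinearMap.fst ℝ ℂ ℝ)

/-- The unknowns of the system `r_y = Re a + Im a * r_u`, `a_y = i (a_x + ā a_u)` satisfied by
Levi-flat graphs in the coordinates `z = x + iy`, `u = Re w`. -/
noncomputable def leviPair (r : ℂ × ℝ → ℝ) (p : ℂ × ℝ) : ℝ × ℂ := (r p, leviSlope r p)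

/-- The right-hand side of the system satisfied by `leviPair r`, as a function of the values
`q.1 = (r, a)` and of the derivatives `q.2` in the directions where `y` is constant. -/
noncomputable def leviEvolution (q : (ℝ × ℂ) × (imCoord.ker →L[ℝ] ℝ × ℂ)) : ℝ × ℂ :=
  (q.1.2.re + q.1.2.im * (q.2 ⟨(0, 1), by simp [imCoord]⟩).1,
    Complex.I * ((q.2 ⟨(1, 0), by simp [imCoord]⟩).2 +
      starRingEnd ℂ q.1.2 * (q.2 ⟨(0, 1), by simp [imCoord]⟩).2))

theorem contDiff_leviPair (hr : ContDiff ℝ ∞ r) : ContDiff ℝ ∞ (leviPair r) :=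
  hr.prodMk (contDiff_leviSlope hr)

theorem contDiff_leviEvolution : ContDiff ℝ ∞ leviEvolution := by
  have ha : ContDiff ℝ ∞ fun q : (ℝ × ℂ) × (imCoord.ker →L[ℝ] ℝ × ℂ) => q.1.2 := by fun_prop
  have hL : ∀ v, ContDiff ℝ ∞ fun q : (ℝ × ℂ) × (imCoord.ker →L[ℝ] ℝ × ℂ) => q.2 v := fun v =>
    contDiff_snd.clm_apply contDiff_const
  exact ((Complex.reCLM.contDiff.comp ha).add ((Complex.imCLM.contDiff.comp ha).mul
    (hL _).fst)).prodMk
    (contDiff_const.mul ((hL _).snd.add ((Complex.conjCLE.contDiff.comp ha).mul (hL _).snd)))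

theorem LeafwiseHolomorphicAt.fderiv_leviPair_I (hr : ContDiff ℝ ∞ r)
    (h : LeafwiseHolomorphicAt (leviSlope r) p) : fderiv ℝ (leviPair r) p (Complex.I, 0) =
      leviEvolution (leviPair r p, (fderiv ℝ (leviPair r) p).comp imCoord.ker.subtypeL) := by
  have hD : fderiv ℝ (leviPair r) p = (fderiv ℝ r p).prod (fderiv ℝ (leviSlope r) p) :=
    ((hr.differentiable (by simp) p).hasFDerivAt.prodMk
      ((contDiff_leviSlope hr).differentiable (by simp) p).hasFDerivAt).fderiv
  rw [hD]
  exact Prod.ext fderiv_I_eq_leviSlope h.fderiv_I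

theorem eqJetOn_fderiv_leviPair_I (hr : ContDiff ℝ ∞ r) (hB : IsOpen B) (hA : A ⊆ closure B)
    (h : ∀ p ∈ B, LeafwiseHolomorphicAt (leviSlope r) p) (n : ℕ) :
    EqJetOn A n (fun p => fderiv ℝ (leviPair r) p (Complex.I, 0)) fun p =>
      leviEvolution (leviPair r p, (fderiv ℝ (leviPair r) p).comp imCoord.ker.subtypeL) := by
  have hV := contDiff_leviPair hr
  have hDV : ContDiff ℝ ∞ (fderiv ℝ (leviPair r)) := hV.fderiv_right (by simp)
  exact .of_eqOn hB hA (hDV.clm_apply contDiff_const)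
    (contDiff_leviEvolution.comp (hV.prodMk (hDV.clm_comp contDiff_const)))
    fun p hp => (h p hp).fderiv_leviPair_I hr

theorem inter_im_eq_zero_subset_closure (hB : IsOpen B) {T : Set ℝ} (hT : 0 ∈ closure T) :
    B ∩ {p | p.1.im = 0} ⊆ closure (B ∩ {p | p.1.im ∈ T}) := fun p hp => by
  have him : IsOpenMap fun q : ℂ × ℝ => q.1.im := Complex.isOpenMap_im.comp isOpenMap_fst
  refine hB.inter_closure ⟨hp.1, him.preimage_closure_subset_closure_preimage ?_⟩
  rwa [Set.mem_preimage, hp.2]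

theorem eventually_add_smul_mem_of_imCoord_eq_zero (hB : IsOpen B) {v : ℂ × ℝ}
    (hp : p ∈ B ∩ {p | p.1.im = 0}) (hv : imCoord v = 0) :
    ∀ᶠ t : ℝ in 𝓝 0, p + t • v ∈ B ∩ {p | p.1.im = 0} := by
  have hline : Continuous fun t : ℝ => p + t • v := by fun_prop
  have hvim : v.1.im = 0 := hv
  filter_upwards [(hB.preimage hline).mem_nhds (by simpa using hp.1)] with t ht
  exact ⟨ht, by simpa [hvim] using hp.2⟩

theorem leviPair_schwarzReflect_eqOn (hr : ContDiff ℝ ∞ r) (hB : IsOpen B)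
    (hr0 : ∀ p ∈ B, p.1.im = 0 → r p = 0) :
    Set.EqOn (leviPair r) (leviPair (schwarzReflect r)) (B ∩ {p | p.1.im = 0}) := fun p hp => by
  have hD : ∀ v, imCoord v = 0 → fderiv ℝ r p v = 0 := fun v hv => by
    have hjet : EqJetOn (B ∩ {p | p.1.im = 0}) 1 r 0 :=
      EqJetOn.succ_iff.2 ⟨fun q hq => hr0 q hq.1 hq.2, .zero⟩
    simpa using (EqJetOn.succ_iff.1 (hjet.fderiv_apply (fun q hq =>
      eventually_add_smul_mem_of_imCoord_eq_zero hB hq hv) hr contDiff_const)).1 hp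
  have hx : fderiv ℝ r p (1, 0) = 0 := hD _ (by simp [imCoord])
  have hu : fderiv ℝ r p (0, 1) = 0 := hD _ (by simp [imCoord])
  refine Prod.ext ?_ ?_
  · simp [leviPair, schwarzReflect, baseConj_eq_self hp.2, hr0 p hp.1 hp.2]
  · change leviSlope r p = leviSlope (schwarzReflect r) p
    rw [leviSlope_schwarzReflect (hr.differentiable (by simp)), baseConj_eq_self hp.2]
    simp [leviSlope, hx, hu]

theorem eqJetOn_schwarzReflect (hr : ContDiff ℝ ∞ r) (hB : IsOpen B) (hBσ : Set.MapsTo baseConj B B)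
    (hr0 : ∀ p ∈ B, p.1.im = 0 → r p = 0)
    (h : ∀ p ∈ B, 0 < p.1.im → LeafwiseHolomorphicAt (leviSlope r) p) (n : ℕ) :
    EqJetOn (B ∩ {p | p.1.im = 0}) n r (schwarzReflect r) := by
  have hr' := contDiff_schwarzReflect hr
  have hpos : IsOpen {p : ℂ × ℝ | 0 < p.1.im} := isOpen_lt (by fun_prop) (by fun_prop)
  have hneg : IsOpen {p : ℂ × ℝ | p.1.im < 0} := isOpen_lt (by fun_prop) (by fun_prop)
  have hevol := eqJetOn_fderiv_leviPair_I hr (hB.inter hpos)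
    (inter_im_eq_zero_subset_closure hB (T := Set.Ioi 0) (by simp)) fun p hp => h p hp.1 hp.2
  have hevol' := eqJetOn_fderiv_leviPair_I hr' (hB.inter hneg)
    (inter_im_eq_zero_subset_closure hB (T := Set.Iio 0) (by simp))
    fun p hp => (h _ (hBσ hp.1) (by simpa [baseConj_apply] using hp.2)).reflect hr
  have hpair : EqJetOn (B ∩ {p | p.1.im = 0}) n (leviPair r) (leviPair (schwarzReflect r)) :=
    .of_evolution (by simp [imCoord])
      (fun p hp v hv => eventually_add_smul_mem_of_imCoord_eq_zero hB hp hv)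
      contDiff_leviEvolution (contDiff_leviPair hr) (contDiff_leviPair hr') hevol hevol'
      (leviPair_schwarzReflect_eqOn hr hB hr0) n
  exact hpair.comp_left contDiff_fst (contDiff_leviPair hr) (contDiff_leviPair hr')

theorem contDiffOn_schwarzExtension (hr : ContDiff ℝ ∞ r) (hB : IsOpen B)
    (hBσ : Set.MapsTo baseConj B B) (hr0 : ∀ p ∈ B, p.1.im = 0 → r p = 0)
    (h : ∀ p ∈ B, 0 < p.1.im → LeafwiseHolomorphicAt (leviSlope r) p) :
    ContDiffOn ℝ ∞ (schwarzExtension r) B := by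
  have him : IsOpenMap fun q : ℂ × ℝ => q.1.im := Complex.isOpenMap_im.comp isOpenMap_fst
  have hfr : frontier {p : ℂ × ℝ | 0 ≤ p.1.im} = {p | p.1.im = 0} := by
    simpa [Set.preimage, frontier_Ici] using
      (him.preimage_frontier_eq_frontier_preimage (by fun_prop) (Set.Ici (0 : ℝ))).symm
  refine EqJetOn.contDiffOn_piecewise (fun n => ?_) hr (contDiff_schwarzReflect hr)
  rw [hfr]
  exact eqJetOn_schwarzReflect hr hB hBσ hr0 h n

theorem leafwiseHolomorphicAt_of_eqOn_schwarzExtension (hr : ContDiff ℝ ∞ r) (hR : ContDiff ℝ ∞ R)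
    (hB : IsOpen B) (hBσ : Set.MapsTo baseConj B B) (hRr : Set.EqOn R (schwarzExtension r) B)
    (h : ∀ p ∈ B, 0 < p.1.im → LeafwiseHolomorphicAt (leviSlope r) p) (hp : p ∈ B) :
    LeafwiseHolomorphicAt (leviSlope R) p := by
  have hpos : ∀ q ∈ B, 0 < q.1.im → LeafwiseHolomorphicAt (leviSlope R) q := fun q hq hy => by
    refine (h q hq hy).congr (leviSlope_congr ?_)
    filter_upwards [hB.mem_nhds hq, (isOpen_lt (f := fun _ => (0 : ℝ)) (by fun_prop)
      (by fun_prop : Continuous fun q : ℂ × ℝ => q.1.im)).mem_nhds hy] with q' hq' hy'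
    rw [hRr hq', schwarzExtension_of_nonneg (le_of_lt hy')]
  rcases lt_trichotomy p.1.im 0 with hy | hy | hy
  · refine ((h _ (hBσ hp) (by simpa [baseConj_apply] using hy)).reflect hr).congr
      (leviSlope_congr ?_)
    filter_upwards [hB.mem_nhds hp, (isOpen_lt (g := fun _ => (0 : ℝ))
      (by fun_prop : Continuous fun q : ℂ × ℝ => q.1.im) (by fun_prop)).mem_nhds hy] with q' hq' hy'
    rw [hRr hq', schwarzExtension_of_neg hy']
  · exact closure_minimal (fun q hq => hpos q hq.1 hq.2)
      (LeafwiseHolomorphicAt.isClosed_setOf (contDiff_leviSlope hR))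
      (inter_im_eq_zero_subset_closure hB (T := Set.Ioi 0) (by simp) ⟨hp, hy⟩)
  · exact hpos p hp hy

end Reflection

section Graph

variable {S : Set (ℂ × ℂ)} {r : ℂ × ℝ → ℝ} {p v : ℂ × ℂ}

/-- The projection `(z, w) ↦ (z, Re w)`. -/
noncomputable def baseProj : (ℂ × ℂ) →L[ℝ] (ℂ × ℝ) :=
  (ContinuousLinearMap.id ℝ ℂ).prodMap Complex.reCLM

theorem baseProj_apply (q : ℂ × ℂ) : baseProj q = (q.1, q.2.re) := rfl

/-- The parametrization `(z, u) ↦ (z, u + i r (z, u))` of the hypersurface `Im w = r (z, Re w)`. -/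
noncomputable def graphLift (r : ℂ × ℝ → ℝ) (q : ℂ × ℝ) : ℂ × ℂ := (q.1, q.2 + r q * Complex.I)

/-- Near `p`, the set `S` is the hypersurface `Im w = r (z, Re w)`. -/
def IsGraphNear (S : Set (ℂ × ℂ)) (r : ℂ × ℝ → ℝ) (p : ℂ × ℂ) : Prop :=
  ∀ᶠ q in 𝓝 p, (q ∈ S ↔ q.2.im = r (baseProj q))

/-- The coordinates `(Re z, Im z, Re w, Im w - r (z, Re w))`, which straighten the hypersurface
`Im w = r (z, Re w)`. -/
noncomputable def graphChart (r : ℂ × ℝ → ℝ) : (ℂ × ℂ) ≃ (Fin 4 → ℝ) where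
  toFun q := ![q.1.re, q.1.im, q.2.re, q.2.im - r (baseProj q)]
  invFun x := (⟨x 0, x 1⟩, ⟨x 2, x 3 + r (⟨x 0, x 1⟩, x 2)⟩)
  left_inv q := Prod.ext rfl (Complex.ext rfl (sub_add_cancel _ _))
  right_inv x := by
    funext i
    fin_cases i <;> simp [baseProj_apply]

theorem baseProj_graphLift (q : ℂ × ℝ) : baseProj (graphLift r q) = q := by
  simp [baseProj_apply, graphLift]

theorem graphLift_baseProj (hp : p.2.im = r (baseProj p)) : graphLift r (baseProj p) = p := by
  rw [graphLift, ← hp]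
  exact Prod.ext rfl (Complex.re_add_im _)

theorem snd_im_graphLift (q : ℂ × ℝ) : (graphLift r q).2.im = r q := by simp [graphLift]

theorem contDiff_graphLift (hr : ContDiff ℝ ∞ r) : ContDiff ℝ ∞ (graphLift r) :=
  contDiff_fst.prodMk ((Complex.ofRealCLM.contDiff.comp contDiff_snd).add
    ((Complex.ofRealCLM.contDiff.comp hr).mul contDiff_const))

theorem graphLift_zero (h0 : r 0 = 0) : graphLift r 0 = 0 := by simp [graphLift, h0]

theorem tendsto_graphLift (hr : ContDiff ℝ ∞ r) (h0 : r 0 = 0) :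
    Filter.Tendsto (graphLift r) (𝓝 0) (𝓝 0) := by
  simpa only [graphLift_zero h0] using (contDiff_graphLift hr).continuous.tendsto 0

theorem contDiff_graphChart (hr : ContDiff ℝ ∞ r) : ContDiff ℝ ∞ (graphChart r) := by
  have hre : ∀ {f : ℂ × ℂ → ℂ}, ContDiff ℝ ∞ f → ContDiff ℝ ∞ fun q => (f q).re :=
    Complex.reCLM.contDiff.comp
  have him : ∀ {f : ℂ × ℂ → ℂ}, ContDiff ℝ ∞ f → ContDiff ℝ ∞ fun q => (f q).im :=
    Complex.imCLM.contDiff.comp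
  refine contDiff_pi.2 fun i => ?_
  fin_cases i
  exacts [hre contDiff_fst, him contDiff_fst, hre contDiff_snd,
    (him contDiff_snd).sub (hr.comp baseProj.contDiff)]

theorem contDiff_graphChart_symm (hr : ContDiff ℝ ∞ r) : ContDiff ℝ ∞ (graphChart r).symm := by
  have hx : ∀ i, ContDiff ℝ ∞ fun x : Fin 4 → ℝ => x i := contDiff_apply ℝ ℝ
  have hmk : ∀ {f g : (Fin 4 → ℝ) → ℝ}, ContDiff ℝ ∞ f → ContDiff ℝ ∞ g →
      ContDiff ℝ ∞ fun x => (⟨f x, g x⟩ : ℂ) := fun hf hg =>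
    Complex.equivRealProdCLM.symm.contDiff.comp (hf.prodMk hg)
  exact (hmk (hx 0) (hx 1)).prodMk
    (hmk (hx 2) ((hx 3).add (hr.comp ((hmk (hx 0) (hx 1)).prodMk (hx 2)))))

theorem isSmoothHypersurface_of_isGraphNear (hr : ContDiff ℝ ∞ r)
    (hS : ∀ p ∈ S, IsGraphNear S r p) : IsSmoothHypersurface S := fun p hp => by
  obtain ⟨U, hSU, hU, hpU⟩ := eventually_nhds_iff.1 (hS p hp)
  let φ : (ℂ × ℂ) ≃ₜ (Fin 4 → ℝ) :=
    ⟨graphChart r, (contDiff_graphChart hr).continuous, (contDiff_graphChart_symm hr).continuous⟩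
  refine ⟨φ.toOpenPartialHomeomorphOfImageEq U hU (φ '' U) rfl,
    ⟨(contDiff_graphChart hr).contDiffOn, (contDiff_graphChart_symm hr).contDiffOn⟩, hpU, ?_⟩
  ext x
  constructor
  · rintro ⟨q, ⟨hqS, hqU⟩, rfl⟩
    exact ⟨⟨q, hqU, rfl⟩, sub_eq_zero.2 ((hSU q hqU).1 hqS)⟩
  · rintro ⟨⟨q, hqU, rfl⟩, hq⟩
    exact ⟨q, ⟨(hSU q hqU).2 (sub_eq_zero.1 hq), hqU⟩, rfl⟩

theorem fderiv_eq_zero_of_mem_tangentVectors {F : Type*} [NormedAddCommGroup F] [NormedSpace ℝ F]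
    {h : ℂ × ℂ → F} (hv : v ∈ tangentVectors S p) (hd : DifferentiableAt ℝ h p)
    (h0 : ∀ᶠ q in 𝓝 p, q ∈ S → h q = 0) : fderiv ℝ h p v = 0 := by
  obtain ⟨γ, hγ, rfl, hS, rfl⟩ := hv
  have hhγ : HasDerivAt (h ∘ γ) (fderiv ℝ h (γ 0) (deriv γ 0)) 0 :=
    hd.hasFDerivAt.comp_hasDerivAt 0 (hγ.differentiableAt (by simp)).hasDerivAt
  refine hhγ.unique ((hasDerivAt_const (0 : ℝ) (0 : F)).congr_of_eventuallyEq ?_)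
  filter_upwards [hS, hγ.continuousAt.eventually h0] with t htS ht
  exact ht htS

namespace IsGraphNear

theorem eventually (hS : IsGraphNear S r p) : ∀ᶠ q in 𝓝 p, IsGraphNear S r q :=
  eventually_eventually_nhds.2 hS

theorem mem_tangentVectors_of_snd_im_eq (hr : ContDiff ℝ ∞ r) (hS : IsGraphNear S r p) (hp : p ∈ S)
    (hv : v.2.im = fderiv ℝ r (baseProj p) (baseProj v)) : v ∈ tangentVectors S p := by
  let γ : ℝ → ℂ × ℂ := fun t => graphLift r (baseProj p + t • baseProj v)
  have hγ : ContDiff ℝ ∞ γ := (contDiff_graphLift hr).comp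
    (contDiff_const.add (contDiff_id.smul contDiff_const))
  have hγ0 : γ 0 = p := by
    simp only [γ, zero_smul, add_zero]
    exact graphLift_baseProj (hS.self_of_nhds.1 hp)
  have hlift : HasFDerivAt (graphLift r) _ (baseProj p) := hasFDerivAt_fst.prodMk
    ((Complex.ofRealCLM.comp (ContinuousLinearMap.snd ℝ ℂ ℝ)).hasFDerivAt.add
      ((Complex.ofRealCLM.hasFDerivAt.comp (baseProj p)
        (hr.differentiable (by simp) _).hasFDerivAt).mul_const' Complex.I))
  refine ⟨γ, hγ.contDiffAt, hγ0, ?_, ?_⟩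
  · filter_upwards [hγ.continuous.continuousAt.eventually (hγ0 ▸ hS)] with t ht
    rw [ht, snd_im_graphLift, baseProj_graphLift]
  · have hγv := (hlift.hasLineDerivAt (baseProj v)).lineDeriv
    refine hγv.trans (Prod.ext rfl ?_)
    rw [baseProj_apply, baseProj_apply] at hv
    simpa [← hv, baseProj_apply, mul_comm] using Complex.re_add_im v.2

theorem mem_tangentVectors_iff (hr : ContDiff ℝ ∞ r) (hS : IsGraphNear S r p) (hp : p ∈ S) :
    v ∈ tangentVectors S p ↔ v.2.im = fderiv ℝ r (baseProj p) (baseProj v) := by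
  refine ⟨fun hv => ?_, hS.mem_tangentVectors_of_snd_im_eq hr hp⟩
  have hd : HasFDerivAt (fun q : ℂ × ℂ => q.2.im - r (baseProj q))
      (Complex.imCLM.comp (ContinuousLinearMap.snd ℝ ℂ ℂ) -
        (fderiv ℝ r (baseProj p)).comp baseProj) p :=
    (Complex.imCLM.comp (ContinuousLinearMap.snd ℝ ℂ ℂ)).hasFDerivAt.sub
      ((hr.differentiable (by simp) _).hasFDerivAt.comp p baseProj.hasFDerivAt)
  have h0 := fderiv_eq_zero_of_mem_tangentVectors hv hd.differentiableAt
    (hS.mono fun q hq hqS => sub_eq_zero.2 (hq.1 hqS))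
  rw [hd.fderiv] at h0
  exact sub_eq_zero.1 h0

theorem mem_complexTangentVectors_iff (hr : ContDiff ℝ ∞ r) (hS : IsGraphNear S r p) (hp : p ∈ S) :
    v ∈ complexTangentVectors S p ↔ v.2 = leviSlope r (baseProj p) * v.1 := by
  have hI : v ∈ (fun v => Complex.I • v) '' tangentVectors S p ↔
      -(Complex.I • v) ∈ tangentVectors S p := by
    refine ⟨?_, fun hv => ⟨_, hv, by simp [smul_smul]⟩⟩
    rintro ⟨w, hw, rfl⟩
    simpa [smul_smul] using hw
  rw [complexTangentVectors, Set.mem_inter_iff, hI, hS.mem_tangentVectors_iff hr hp,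
    hS.mem_tangentVectors_iff hr hp, eq_leviSlope_mul_iff, and_comm, map_neg, map_neg,
    Prod.snd_neg, Complex.neg_im, neg_inj]
  rfl

theorem leafwiseHolomorphicAt (hr : ContDiff ℝ ∞ r) (hS : IsGraphNear S r p) (hp : p ∈ S)
    (hflat : IsLeviFlat S) : LeafwiseHolomorphicAt (leviSlope r) (baseProj p) := fun ζ => by
  obtain ⟨V, hV, hVo, hpV⟩ := eventually_nhds_iff.1 hS.eventually
  let a : ℂ × ℂ → ℂ := fun q => leviSlope r (baseProj q)
  have ha : ContDiff ℝ ∞ a := (contDiff_leviSlope hr).comp baseProj.contDiff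
  have hDa : HasFDerivAt a ((fderiv ℝ (leviSlope r) (baseProj p)).comp baseProj) p :=
    ((contDiff_leviSlope hr).differentiable (by simp) _).hasFDerivAt.comp p baseProj.hasFDerivAt
  let Z : ℂ → ℂ × ℂ → ℂ × ℂ := fun ξ q => (ξ, a q * ξ)
  have hZ : ∀ ξ, ContDiffOn ℝ ∞ (Z ξ) V := fun ξ =>
    (contDiff_const.prodMk (ha.mul contDiff_const)).contDiffOn
  have hDZ : ∀ ξ v, fderiv ℝ (Z ξ) p v =
      (0, fderiv ℝ (leviSlope r) (baseProj p) (baseProj v) * ξ) := fun ξ v => by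
    have hDξ : HasFDerivAt (Z ξ) _ p := (hasFDerivAt_const ξ p).prodMk (hDa.mul_const' ξ)
    simp [hDξ.fderiv, mul_comm]
  have hZS : ∀ ξ, ∀ q ∈ S ∩ V, Z ξ q ∈ complexTangentVectors S q := fun ξ q hq =>
    ((hV q hq.2).mem_complexTangentVectors_iff hr hq.1).2 rfl
  have hbr := hflat V (Z 1) (Z ζ) hVo (hZ 1) (hZ ζ) (hZS 1) (hZS ζ) p ⟨hp, hpV⟩
  rw [hS.mem_complexTangentVectors_iff hr hp, VectorField.lieBracket, hDZ, hDZ] at hbr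
  simp only [Prod.mk_sub_mk, sub_zero, mul_zero, baseProj_apply, Z, mul_one, sub_eq_zero] at hbr
  rw [mul_comm ζ]
  exact hbr.symm

theorem snd_fderiv_of_mem_complexTangentVectors (hr : ContDiff ℝ ∞ r) (hS : IsGraphNear S r p)
    (hp : p ∈ S) (h : LeafwiseHolomorphicAt (leviSlope r) (baseProj p)) {Z : ℂ × ℂ → ℂ × ℂ}
    (hZ : DifferentiableAt ℝ Z p) (hZS : ∀ᶠ q in 𝓝 p, q ∈ S → Z q ∈ complexTangentVectors S q)
    (hv : v ∈ complexTangentVectors S p) :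
    (fderiv ℝ Z p v).2 = leviSlope r (baseProj p) * (fderiv ℝ Z p v).1 +
      v.1 * (Z p).1 * fderiv ℝ (leviSlope r) (baseProj p) (1, (leviSlope r (baseProj p)).re) := by
  have hD : HasFDerivAt (fun q => (Z q).2 - leviSlope r (baseProj q) * (Z q).1) _ p :=
    hZ.hasFDerivAt.snd.sub ((((contDiff_leviSlope hr).differentiable (by simp) _).hasFDerivAt.comp p
      baseProj.hasFDerivAt).mul hZ.hasFDerivAt.fst)
  have h0 := fderiv_eq_zero_of_mem_tangentVectors hv.2 hD.differentiableAt (by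
    filter_upwards [hS.eventually, hZS] with q hq hqZ hqS
    exact sub_eq_zero.2 ((hq.mem_complexTangentVectors_iff hr hqS).1 (hqZ hqS)))
  have hbase : baseProj v = (v.1, (leviSlope r (baseProj p) * v.1).re) := by
    rw [← (hS.mem_complexTangentVectors_iff hr hp).1 hv, baseProj_apply]
  simp only [hD.fderiv, sub_apply, add_apply, smul_apply, ContinuousLinearMap.comp_apply,
    smul_eq_mul, hbase, h v.1, ContinuousLinearMap.coe_fst', ContinuousLinearMap.coe_snd',
    Function.comp_apply] at h0
  linear_combination h0

end IsGraphNear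

theorem isLeviFlat_of_leafwiseHolomorphicAt (hr : ContDiff ℝ ∞ r)
    (hS : ∀ p ∈ S, IsGraphNear S r p)
    (h : ∀ p ∈ S, LeafwiseHolomorphicAt (leviSlope r) (baseProj p)) : IsLeviFlat S := by
  intro V X Y hV hX hY hXS hYS p hp
  have hDZ := fun {Z : ℂ × ℂ → ℂ × ℂ} {v : ℂ × ℂ} (hZ : ContDiffOn ℝ ∞ Z V)
      (hZS : ∀ q ∈ S ∩ V, Z q ∈ complexTangentVectors S q) =>
    (hS p hp.1).snd_fderiv_of_mem_complexTangentVectors (v := v) hr hp.1 (h p hp.1)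
      ((hZ.contDiffAt (hV.mem_nhds hp.2)).differentiableAt (by simp))
      ((hV.eventually_mem hp.2).mono fun q hqV hqS => hZS q ⟨hqS, hqV⟩)
  rw [(hS p hp.1).mem_complexTangentVectors_iff hr hp.1, VectorField.lieBracket, Prod.snd_sub,
    Prod.fst_sub, hDZ hX hXS (hYS p hp), hDZ hY hYS (hXS p hp)]
  ring

end Graph

section Conjugation

variable {H bH : Set (ℂ × ℂ)} {r : ℂ × ℝ → ℝ} {p : ℂ × ℂ} {ε : ℝ}

/-- The conclusion of the reflection theorem at the origin: the union of `H` with its conjugate is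
a smooth Levi-flat hypersurface in some conjugation-invariant neighbourhood of `0`. -/
def HasLeviFlatReflection (H : Set (ℂ × ℂ)) : Prop :=
  ∃ U : Set (ℂ × ℂ), IsOpen U ∧ (0 : ℂ × ℂ) ∈ U ∧ U = conjC2 '' U ∧
    IsSmoothHypersurface ((H ∩ U) ∪ conjC2 '' (H ∩ U)) ∧
    IsLeviFlat ((H ∩ U) ∪ conjC2 '' (H ∩ U))

/-- Near `0`, the set `H` is the half `0 ≤ Im z` of the hypersurface `Im w = r (z, Re w)`. -/
def IsHalfGraph (H : Set (ℂ × ℂ)) (r : ℂ × ℝ → ℝ) : Prop :=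
  ∀ᶠ p in 𝓝 (0 : ℂ × ℂ), (p ∈ H ↔ 0 ≤ p.1.im ∧ p.2.im = r (baseProj p))

theorem conjC2_involutive : Function.Involutive conjC2 := fun p => by simp [conjC2]

theorem image_conjC2 (S : Set (ℂ × ℂ)) : conjC2 '' S = conjC2 ⁻¹' S :=
  congrFun (Set.image_eq_preimage_of_inverse conjC2_involutive conjC2_involutive) S

theorem mem_realPlane_iff_conjC2_eq : p ∈ realPlane ↔ conjC2 p = p := by
  simp [realPlane, conjC2, Prod.ext_iff, Complex.conj_eq_iff_im]

theorem conjC2_mem_ball : conjC2 p ∈ Metric.ball (0 : ℂ × ℂ) ε ↔ p ∈ Metric.ball 0 ε := by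
  simp [conjC2, Prod.norm_def]

theorem baseProj_conjC2 (p : ℂ × ℂ) : baseProj (conjC2 p) = baseConj (baseProj p) := rfl

theorem mapsTo_baseConj_ball :
    Set.MapsTo baseConj (Metric.ball (0 : ℂ × ℝ) ε) (Metric.ball 0 ε) := fun q hq => by
  simpa [baseConj_apply, Prod.norm_def] using hq

theorem mapsTo_baseProj_ball :
    Set.MapsTo baseProj (Metric.ball (0 : ℂ × ℂ) ε) (Metric.ball 0 ε) := fun p hp => by
  simp only [Metric.mem_ball, dist_zero_right, Prod.norm_def, baseProj_apply, max_lt_iff] at hp ⊢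
  exact ⟨hp.1, (Complex.abs_re_le_norm _).trans_lt hp.2⟩

theorem mem_union_conjC2_iff (hp : p ∈ H ↔ 0 ≤ p.1.im ∧ p.2.im = r (baseProj p))
    (hp' : conjC2 p ∈ H ↔ 0 ≤ (conjC2 p).1.im ∧ (conjC2 p).2.im = r (baseProj (conjC2 p)))
    (hr0 : p.1.im = 0 → r (baseProj p) = 0) :
    p ∈ H ∪ conjC2 '' H ↔ p.2.im = schwarzExtension r (baseProj p) := by
  have h1 : (conjC2 p).1.im = -p.1.im := Complex.conj_im _
  have h2 : (conjC2 p).2.im = -p.2.im := Complex.conj_im _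
  rw [Set.mem_union, image_conjC2, Set.mem_preimage, hp, hp', h1, h2, baseProj_conjC2]
  rcases lt_trichotomy p.1.im 0 with hy | hy | hy
  · rw [schwarzExtension_of_neg (show (baseProj p).1.im < 0 from hy), schwarzReflect]
    grind
  · rw [schwarzExtension_of_nonneg (show 0 ≤ (baseProj p).1.im from hy.ge),
      baseConj_eq_self (show (baseProj p).1.im = 0 from hy)]
    grind
  · rw [schwarzExtension_of_nonneg (show 0 ≤ (baseProj p).1.im from hy.le)]
    grind

theorem IsHalfGraph.eventually_leafwiseHolomorphicAt (hH : IsHalfGraph H r) (hr : ContDiff ℝ ∞ r)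
    (hr0 : r 0 = 0) (hbH : bH ⊆ realPlane) (hflat : IsLeviFlat (H \ bH)) :
    ∀ᶠ q in 𝓝 (0 : ℂ × ℝ), 0 < q.1.im → LeafwiseHolomorphicAt (leviSlope r) q := by
  filter_upwards [(tendsto_graphLift hr hr0).eventually (eventually_eventually_nhds.2 hH)]
    with q hq hy
  have hpos : ∀ᶠ p : ℂ × ℂ in 𝓝 (graphLift r q), 0 < p.1.im :=
    (Complex.continuous_im.comp continuous_fst).continuousAt.eventually (lt_mem_nhds hy)
  have hgraph : IsGraphNear (H \ bH) r (graphLift r q) := by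
    filter_upwards [hq, hpos] with p hp hp0
    have hpb : p ∉ bH := fun h => hp0.ne' (hbH h).1
    simp [hp, hpb, hp0.le]
  rw [← baseProj_graphLift q]
  refine hgraph.leafwiseHolomorphicAt hr (hgraph.self_of_nhds.2 ?_) hflat
  rw [baseProj_graphLift, snd_im_graphLift]

theorem IsHalfGraph.hasLeviFlatReflection (hH : IsHalfGraph H r) (hr : ContDiff ℝ ∞ r)
    (hr0 : ∀ᶠ q in 𝓝 (0 : ℂ × ℝ), q.1.im = 0 → r q = 0) (hbH : bH ⊆ realPlane)
    (hflat : IsLeviFlat (H \ bH)) : HasLeviFlatReflection H := by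
  have hleaf := hH.eventually_leafwiseHolomorphicAt hr (hr0.self_of_nhds rfl) hbH hflat
  obtain ⟨δ, hδ, hδr⟩ := Metric.eventually_nhds_iff_ball.1 (hr0.and hleaf)
  obtain ⟨R, hR, hRr⟩ := exists_contDiff_eventuallyEq Metric.isOpen_ball (Metric.mem_ball_self hδ)
    (contDiffOn_schwarzExtension hr Metric.isOpen_ball mapsTo_baseConj_ball
      (fun q hq => (hδr q hq).1) fun q hq => (hδr q hq).2)
  obtain ⟨ε₁, hε₁, hB⟩ := Metric.eventually_nhds_iff_ball.1 ((hr0.and hleaf).and hRr)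
  obtain ⟨ε₂, hε₂, hU⟩ := Metric.eventually_nhds_iff_ball.1 hH
  let ε := min ε₁ ε₂
  let S := H ∩ Metric.ball 0 ε ∪ conjC2 '' (H ∩ Metric.ball 0 ε)
  have hBε : ∀ q ∈ Metric.ball (0 : ℂ × ℝ) ε, _ := fun q hq =>
    hB q (Metric.ball_subset_ball (min_le_left _ _) hq)
  have hUε : ∀ p ∈ Metric.ball (0 : ℂ × ℂ) ε, _ := fun p hp =>
    hU p (Metric.ball_subset_ball (min_le_right _ _) hp)
  have hball : conjC2 '' Metric.ball 0 ε = Metric.ball 0 ε :=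
    (image_conjC2 _).trans (Set.ext fun p => conjC2_mem_ball)
  have hSε : S = (H ∪ conjC2 '' H) ∩ Metric.ball 0 ε := by
    simp only [S]
    rw [Set.image_inter conjC2_involutive.injective, hball, Set.union_inter_distrib_right]
  have hSR : ∀ p ∈ S, IsGraphNear S R p := fun p hp => by
    filter_upwards [Metric.isOpen_ball.mem_nhds (hSε.subset hp).2] with q hq
    have hqB := hBε _ (mapsTo_baseProj_ball hq)
    rw [hSε, Set.mem_inter_iff, and_iff_left hq, hqB.2]
    exact mem_union_conjC2_iff (hUε q hq) (hUε _ (conjC2_mem_ball.2 hq)) hqB.1.1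
  refine ⟨Metric.ball 0 ε, Metric.isOpen_ball, Metric.mem_ball_self (lt_min hε₁ hε₂), hball.symm,
    isSmoothHypersurface_of_isGraphNear hR hSR, isLeviFlat_of_leafwiseHolomorphicAt hR hSR ?_⟩
  intro p hp
  exact leafwiseHolomorphicAt_of_eqOn_schwarzExtension hr hR Metric.isOpen_ball mapsTo_baseConj_ball
    (fun q hq => (hBε q hq).2) (fun q hq => (hBε q hq).1.2)
    (mapsTo_baseProj_ball (hSε.subset hp).2)

end Conjugation

section NormalForm

variable {U : Set (ℂ × ℂ)}

/-- The imaginary parts `(Im z, Im w)`, whose kernel is the real plane. -/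
noncomputable def imPart : (ℂ × ℂ) →L[ℝ] (ℝ × ℝ) := Complex.imCLM.prodMap Complex.imCLM

theorem imPart_apply (p : ℂ × ℂ) : imPart p = (p.1.im, p.2.im) := rfl

theorem mem_realPlane_iff_imPart_eq_zero {p : ℂ × ℂ} : p ∈ realPlane ↔ imPart p = 0 :=
  Prod.mk_eq_zero.symm

theorem exists_isGraphNear_setOf_eq_zero {ρ : ℂ × ℂ → ℝ} {p : ℂ × ℂ} (hρ : ContDiffOn ℝ ∞ ρ U)
    (hU : IsOpen U) (hp : p ∈ U) (h0 : ρ p = 0)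
    (hρ' : HasFDerivAt ρ (Complex.imCLM.comp (ContinuousLinearMap.snd ℝ ℂ ℂ)) p) :
    ∃ r : ℂ × ℝ → ℝ, ContDiff ℝ ∞ r ∧ IsGraphNear {q | ρ q = 0} r p := by
  let Ψ : ℂ × ℂ → ℂ × ℂ := fun q => (q.1, q.2.re + ρ q * Complex.I)
  have hΨ : ContDiffOn ℝ ∞ Ψ U := contDiffOn_fst.prodMk
    ((Complex.ofRealCLM.comp Complex.reCLM).contDiff.comp_contDiffOn contDiffOn_snd |>.add
      ((Complex.ofRealCLM.contDiff.comp_contDiffOn hρ).mul contDiffOn_const))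
  have hΨ' : HasFDerivAt Ψ (ContinuousLinearEquiv.refl ℝ (ℂ × ℂ) : _ →L[ℝ] _) p := by
    refine (hasFDerivAt_fst.prodMk ((((Complex.ofRealCLM.comp Complex.reCLM).hasFDerivAt).comp p
      hasFDerivAt_snd).add ((Complex.ofRealCLM.hasFDerivAt.comp p hρ').mul_const'
        Complex.I))).congr_fderiv ?_
    refine ContinuousLinearMap.ext fun v => Prod.ext rfl ?_
    simpa [mul_comm] using Complex.re_add_im v.2
  obtain ⟨e, hpe, -, he, hsymm⟩ := exists_openPartialHomeomorph_contDiffOn_symm hΨ hU hp hΨ'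
  have hj : ContDiff ℝ ∞ (graphLift 0) := contDiff_graphLift contDiff_const
  have hjρ : ∀ q, ρ q = 0 → e q = graphLift 0 (baseProj q) := fun q hq => by
    rw [he]
    simp only [Ψ, hq]
    rfl
  have hjp : graphLift 0 (baseProj p) ∈ e.target := hjρ p h0 ▸ e.map_source hpe
  obtain ⟨r, hr, hrr⟩ := exists_contDiff_eventuallyEq (e.open_target.preimage hj.continuous) hjp
    (Complex.imCLM.contDiff.comp_contDiffOn (hsymm.comp hj.contDiffOn fun _ hq => hq).snd)
  refine ⟨r, hr, ?_⟩
  filter_upwards [baseProj.continuous.continuousAt.eventually hrr, e.open_source.mem_nhds hpe,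
    (hj.continuous.comp baseProj.continuous).continuousAt.eventually_mem
      (e.open_target.mem_nhds hjp)] with q hrq hqe hqt
  rw [hrq]
  refine ⟨fun hq => by simp [← hjρ q hq, e.left_inv hqe], fun hq => ?_⟩
  have hΨq : Ψ (e.symm (graphLift 0 (baseProj q))) = graphLift 0 (baseProj q) :=
    he ▸ e.right_inv hqt
  change q.2.im = (e.symm (graphLift 0 (baseProj q))).2.im at hq
  generalize e.symm (graphLift 0 (baseProj q)) = q' at hq hΨq
  simp only [Ψ, graphLift, baseProj_apply, Prod.mk.injEq, Complex.ext_iff] at hΨq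
  have hqq : q' = q := Prod.ext (Complex.ext hΨq.1.1 hΨq.1.2)
    (Complex.ext (by simpa using hΨq.2.1) hq.symm)
  simpa [hqq] using hΨq.2.2

theorem exists_isHalfGraph {σ : ℂ × ℂ → ℝ × ℝ} (hσ : ContDiffOn ℝ ∞ σ U) (hU : IsOpen U)
    (h0 : (0 : ℂ × ℂ) ∈ U) (hσ' : HasFDerivAt σ imPart 0)
    (hreal : ∀ᶠ p in 𝓝 (0 : ℂ × ℂ), p ∈ realPlane → σ p = 0) :
    ∃ r : ℂ × ℝ → ℝ, ContDiff ℝ ∞ r ∧ (∀ᶠ q in 𝓝 (0 : ℂ × ℝ), q.1.im = 0 → r q = 0) ∧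
      IsHalfGraph {p | 0 ≤ (σ p).1 ∧ (σ p).2 = 0} r := by
  have h0σ : σ 0 = 0 := hreal.self_of_nhds ⟨rfl, rfl⟩
  obtain ⟨r, hr, hgraph⟩ :=
    exists_isGraphNear_setOf_eq_zero hσ.snd hU h0 (by rw [h0σ]; rfl) hσ'.snd
  have hj := tendsto_graphLift (r := 0) contDiff_const rfl
  have hr0 : ∀ᶠ q in 𝓝 (0 : ℂ × ℝ), q.1.im = 0 → r q = 0 := by
    filter_upwards [hj.eventually hreal, hj.eventually hgraph] with q hq hqr hy
    have hσq : σ (graphLift 0 q) = 0 := hq ⟨hy, by simp [graphLift]⟩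
    simpa [baseProj_graphLift, snd_im_graphLift] using (hqr.1 (by simp [hσq])).symm
  have hlift := tendsto_graphLift hr (hr0.self_of_nhds rfl)
  have hDlift : HasStrictFDerivAt (graphLift r) _ 0 := hasStrictFDerivAt_fst.prodMk
    ((contDiff_graphLift hr).snd.contDiffAt.hasStrictFDerivAt (by simp))
  have hDσ : HasStrictFDerivAt σ imPart (graphLift r 0) := by
    rw [graphLift_zero (hr0.self_of_nhds rfl)]
    exact (hσ.contDiffAt (hU.mem_nhds h0)).hasStrictFDerivAt' hσ' (by simp)
  have hD : HasStrictFDerivAt (fun q => (σ (graphLift r q)).1) imCoord 0 :=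
    (hDσ.comp 0 hDlift).fst
  have hsign := eventually_nonneg_iff_of_hasStrictFDerivAt hD (e := (Complex.I, 0))
    (by simp [imCoord]) (by
      filter_upwards [hlift.eventually hreal, hr0] with q hq hr0q hy
      rw [hq ⟨hy, by rw [snd_im_graphLift, hr0q hy]⟩, Prod.fst_zero])
  refine ⟨r, hr, hr0, ?_⟩
  have hbase : Filter.Tendsto baseProj (𝓝 0) (𝓝 0) := by simpa using baseProj.continuous.tendsto 0
  filter_upwards [hgraph, hbase.eventually hsign] with p hp hps
  rw [show (σ p).2 = 0 ↔ p.2.im = r (baseProj p) from hp]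
  refine and_congr_left fun hpr => ?_
  rwa [graphLift_baseProj hpr] at hps

end NormalForm

section ChangeOfCoordinates

variable {S T H : Set (ℂ × ℂ)} {p v : ℂ × ℂ}

theorem lieBracket_pushforward {E F : Type*} [NormedAddCommGroup E] [NormedSpace ℝ E]
    [NormedAddCommGroup F] [NormedSpace ℝ F] [CompleteSpace F] (Φ : E ≃L[ℝ] F) {X Y : E → E} {p : E}
    (hX : DifferentiableAt ℝ X p) (hY : DifferentiableAt ℝ Y p) :
    VectorField.lieBracket ℝ (Φ ∘ X ∘ Φ.symm) (Φ ∘ Y ∘ Φ.symm) (Φ p) =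
      Φ (VectorField.lieBracket ℝ X Y p) := by
  have hpull : ∀ Z : E → E, VectorField.pullback ℝ Φ.symm Z = Φ ∘ Z ∘ Φ.symm := fun Z =>
    funext fun q => VectorField.pullback_eq_of_fderiv_eq (M := Φ.symm) Φ.symm.fderiv.symm Z
  have h := VectorField.pullback_lieBracket (x := Φ p) (V := X) (W := Y) (n := 2) (by simp)
    Φ.symm.contDiff.contDiffAt (by simpa using hX) (by simpa using hY)
  simpa only [hpull, Function.comp_apply, Φ.symm_apply_apply] using h.symm

theorem map_mem_tangentVectors (Φ : (ℂ × ℂ) →L[ℝ] (ℂ × ℂ)) (hΦ : Set.MapsTo Φ S T)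
    (hv : v ∈ tangentVectors S p) : Φ v ∈ tangentVectors T (Φ p) := by
  obtain ⟨γ, hγ, rfl, hS, rfl⟩ := hv
  exact ⟨Φ ∘ γ, Φ.contDiff.contDiffAt.comp 0 hγ, rfl, hS.mono fun t ht => hΦ ht,
    (Φ.hasFDerivAt.comp_hasDerivAt (0 : ℝ) (hγ.differentiableAt (by simp)).hasDerivAt).deriv⟩

theorem map_mem_complexTangentVectors (Φ : (ℂ × ℂ) →L[ℂ] (ℂ × ℂ)) (hΦ : Set.MapsTo Φ S T)
    (hv : v ∈ complexTangentVectors S p) : Φ v ∈ complexTangentVectors T (Φ p) := by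
  obtain ⟨⟨w, hw, rfl⟩, hv⟩ := hv
  exact ⟨⟨Φ w, map_mem_tangentVectors (Φ.restrictScalars ℝ) hΦ hw, by simp⟩,
    map_mem_tangentVectors (Φ.restrictScalars ℝ) hΦ hv⟩

theorem mem_complexTangentVectors_preimage_iff (Φ : (ℂ × ℂ) ≃L[ℂ] (ℂ × ℂ)) :
    v ∈ complexTangentVectors (Φ ⁻¹' S) p ↔ Φ v ∈ complexTangentVectors S (Φ p) := by
  refine ⟨map_mem_complexTangentVectors (Φ : _ →L[ℂ] _) (Set.mapsTo_preimage Φ S), fun h => ?_⟩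
  have hback : Set.MapsTo Φ.symm S (Φ ⁻¹' S) := fun q hq => by simpa using hq
  simpa using map_mem_complexTangentVectors (Φ.symm : _ →L[ℂ] _) hback h

theorem IsLeviFlat.preimage (hS : IsLeviFlat S) (Φ : (ℂ × ℂ) ≃L[ℂ] (ℂ × ℂ)) :
    IsLeviFlat (Φ ⁻¹' S) := by
  intro V X Y hV hX hY hXS hYS p hp
  let Ψ : (ℂ × ℂ) ≃L[ℝ] (ℂ × ℂ) := Φ.restrictScalars ℝ
  have hsmooth : ∀ {Z : ℂ × ℂ → ℂ × ℂ}, ContDiffOn ℝ ∞ Z V →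
      ContDiffOn ℝ ∞ (Ψ ∘ Z ∘ Ψ.symm) (Ψ.symm ⁻¹' V) := fun hZ =>
    Ψ.contDiff.comp_contDiffOn (hZ.comp Ψ.symm.contDiff.contDiffOn fun _ hq => hq)
  have htangent : ∀ {Z : ℂ × ℂ → ℂ × ℂ},
      (∀ q ∈ Φ ⁻¹' S ∩ V, Z q ∈ complexTangentVectors (Φ ⁻¹' S) q) →
      ∀ q ∈ S ∩ Ψ.symm ⁻¹' V, (Ψ ∘ Z ∘ Ψ.symm) q ∈ complexTangentVectors S q := fun hZS q hq => by
    have hq' : Φ (Ψ.symm q) = q := Ψ.apply_symm_apply q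
    have h := (mem_complexTangentVectors_preimage_iff Φ).1
      (hZS (Ψ.symm q) ⟨by simpa [hq'] using hq.1, hq.2⟩)
    rwa [hq'] at h
  have hdiff : ∀ {Z : ℂ × ℂ → ℂ × ℂ}, ContDiffOn ℝ ∞ Z V → DifferentiableAt ℝ Z p := fun hZ =>
    (hZ.contDiffAt (hV.mem_nhds hp.2)).differentiableAt (by simp)
  have h := hS _ _ _ (hV.preimage Ψ.symm.continuous) (hsmooth hX) (hsmooth hY) (htangent hXS)
    (htangent hYS) (Ψ p) ⟨hp.1, by simpa using hp.2⟩
  rw [lieBracket_pushforward Ψ (hdiff hX) (hdiff hY)] at h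
  exact (mem_complexTangentVectors_preimage_iff Φ).2 h

theorem IsSmoothHypersurface.preimage (hS : IsSmoothHypersurface S)
    (Φ : (ℂ × ℂ) ≃L[ℝ] (ℂ × ℂ)) : IsSmoothHypersurface (Φ ⁻¹' S) := fun p hp => by
  obtain ⟨e, he, hpe, heS⟩ := hS (Φ p) hp
  refine ⟨Φ.toHomeomorph.transOpenPartialHomeomorph e,
    ⟨he.1.comp Φ.contDiff.contDiffOn fun _ hq => hq, Φ.symm.contDiff.comp_contDiffOn he.2⟩,
    hpe, Eq.trans ?_ heS⟩
  change (e ∘ Φ) '' (Φ ⁻¹' (S ∩ e.source)) = _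
  rw [Set.image_comp, Set.image_preimage_eq _ Φ.surjective]

theorem map_mem_realPlane_iff {Φ : (ℂ × ℂ) ≃L[ℂ] (ℂ × ℂ)}
    (hΦ : ∀ p, Φ (conjC2 p) = conjC2 (Φ p)) : Φ p ∈ realPlane ↔ p ∈ realPlane := by
  rw [mem_realPlane_iff_conjC2_eq, mem_realPlane_iff_conjC2_eq, ← hΦ, Φ.injective.eq_iff]

theorem HasLeviFlatReflection.preimage (hH : HasLeviFlatReflection H)
    (Φ : (ℂ × ℂ) ≃L[ℂ] (ℂ × ℂ)) (hΦ : ∀ p, Φ (conjC2 p) = conjC2 (Φ p)) :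
    HasLeviFlatReflection (Φ ⁻¹' H) := by
  obtain ⟨U, hU, h0, hUconj, hS, hflat⟩ := hH
  have hconj : ∀ T : Set (ℂ × ℂ), conjC2 '' (Φ ⁻¹' T) = Φ ⁻¹' (conjC2 '' T) := fun T => by
    simp only [image_conjC2, ← Set.preimage_comp]
    exact congrArg (· ⁻¹' T) (funext hΦ)
  have hunion : Φ ⁻¹' H ∩ Φ ⁻¹' U ∪ conjC2 '' (Φ ⁻¹' H ∩ Φ ⁻¹' U) =
      Φ ⁻¹' (H ∩ U ∪ conjC2 '' (H ∩ U)) := by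
    rw [← Set.preimage_inter, hconj, Set.preimage_union]
  refine ⟨Φ ⁻¹' U, hU.preimage Φ.continuous, by simpa using h0, ?_, ?_, ?_⟩
  · rw [hconj, ← hUconj]
  · exact hunion ▸ hS.preimage (Φ.restrictScalars ℝ)
  · exact hunion ▸ hflat.preimage Φ

end ChangeOfCoordinates

section BoundaryCoordinates

variable {H bH : Set (ℂ × ℂ)} {e : OpenPartialHomeomorph (ℂ × ℂ) (Fin 4 → ℝ)}

/-- The real parts `(Re z, Re w)`. -/
noncomputable def rePart : (ℂ × ℂ) →L[ℝ] (ℝ × ℝ) := Complex.reCLM.prodMap Complex.reCLM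

/-- The defining coordinates `(x₃, x₄)` of the boundary in a boundary chart. -/
noncomputable def boundaryCoords : (Fin 4 → ℝ) →L[ℝ] (ℝ × ℝ) :=
  (ContinuousLinearMap.proj 2).prod (ContinuousLinearMap.proj 3)

theorem mem_iff_of_image_inter_eq {α β : Type*} {f : α → β} {A s : Set α} {B : Set β} {x : α}
    (hf : Set.InjOn f s) (h : f '' (A ∩ s) = B) (hx : x ∈ s) : x ∈ A ↔ f x ∈ B := by
  rw [← h, hf.mem_image_iff Set.inter_subset_right hx, Set.mem_inter_iff, and_iff_left hx]

theorem eq_of_rePart_eq {p q : ℂ × ℂ} (hp : p ∈ realPlane) (hq : q ∈ realPlane)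
    (h : rePart p = rePart q) : p = q :=
  Prod.ext (Complex.ext (congrArg Prod.fst h) (hp.1.trans hq.1.symm))
    (Complex.ext (congrArg Prod.snd h) (hp.2.trans hq.2.symm))

theorem eventually_mem_range_of_realPlane {c : ℝ × ℝ → ℂ × ℂ} {c' : (ℝ × ℝ) →L[ℝ] (ℂ × ℂ)}
    {t : ℝ × ℝ} (hc : HasStrictFDerivAt c c' t) (hc' : Function.Injective c')
    (hreal : ∀ s, c s ∈ realPlane) : ∀ᶠ p in 𝓝 (c t), p ∈ realPlane → p ∈ Set.range c := by
  have him : imPart.comp c' = 0 := by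
    have h := (imPart.hasFDerivAt.comp t hc.hasFDerivAt)
    rw [show imPart ∘ c = fun _ => 0 from
      funext fun s => mem_realPlane_iff_imPart_eq_zero.1 (hreal s)] at h
    exact h.unique (hasFDerivAt_const 0 t)
  have hmem : ∀ s, c' s ∈ realPlane := fun s =>
    mem_realPlane_iff_imPart_eq_zero.2 (congrArg (· s) him)
  have hinj : Function.Injective (rePart.comp c') := fun s s' hs =>
    hc' (eq_of_rePart_eq (hmem s) (hmem s') hs)
  have hmap := (rePart.hasStrictFDerivAt.comp t hc).map_nhds_eq_of_surj
    (LinearMap.range_eq_top.2 (LinearMap.injective_iff_surjective.1 hinj))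
  have hrange : ∀ᶠ x in 𝓝 (rePart (c t)), ∃ s, rePart (c s) = x :=
    (show 𝓝 (rePart (c t)) = _ from hmap.symm) ▸
      Filter.eventually_map.2 (Filter.Eventually.of_forall fun s => ⟨s, rfl⟩)
  filter_upwards [rePart.continuous.continuousAt.eventually hrange] with p ⟨s, hs⟩ hp
  exact ⟨s, eq_of_rePart_eq (hreal s) hp hs⟩

theorem IsSmoothDiffeo.fderiv_apply_fderiv_symm (he : IsSmoothDiffeo e) {p : ℂ × ℂ}
    (hp : p ∈ e.source) (x : Fin 4 → ℝ) : fderiv ℝ e p (fderiv ℝ e.symm (e p) x) = x := by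
  have ht := e.map_source hp
  have h := (he.2.contDiffAt (e.open_target.mem_nhds ht)).differentiableAt (by simp)
  have h' := (he.1.contDiffAt (e.open_source.mem_nhds hp)).differentiableAt (by simp)
  rw [← e.left_inv hp] at h'
  have hcomp := fderiv_comp (e p) h' h
  have hid : e ∘ e.symm =ᶠ[𝓝 (e p)] id := e.eventually_right_inverse ht
  rw [e.left_inv hp, hid.fderiv_eq, fderiv_id] at hcomp
  exact (congrArg (· x) hcomp).symm

theorem eventually_mem_of_subset_realPlane (he : IsSmoothDiffeo e) (h0s : (0 : ℂ × ℂ) ∈ e.source)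
    (h0 : (0 : ℂ × ℂ) ∈ bH) (hbH : bH ⊆ realPlane)
    (heb : e '' (bH ∩ e.source) = {x | x 2 = 0 ∧ x 3 = 0}) :
    ∀ᶠ p in 𝓝 (0 : ℂ × ℂ), p ∈ realPlane → p ∈ bH := by
  let ι : (ℝ × ℝ) →L[ℝ] (Fin 4 → ℝ) := ContinuousLinearMap.pi
    ![ContinuousLinearMap.fst ℝ ℝ ℝ, ContinuousLinearMap.snd ℝ ℝ ℝ, 0, 0]
  let c : ℝ × ℝ → ℂ × ℂ := fun t => e.symm (e 0 + ι t)
  have he0 : e 0 ∈ {x : Fin 4 → ℝ | x 2 = 0 ∧ x 3 = 0} := heb ▸ ⟨0, ⟨h0, h0s⟩, rfl⟩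
  have hcb : ∀ t, c t ∈ bH := fun t => by
    obtain ⟨q, hq, hqe⟩ := heb.superset
      (show e 0 + ι t ∈ _ from ⟨by simp [ι, he0.1], by simp [ι, he0.2]⟩)
    simp only [c]
    rw [← hqe, e.left_inv hq.2]
    exact hq.1
  have hsymm : HasStrictFDerivAt e.symm (fderiv ℝ e.symm (e 0)) (e 0 + ι 0) := by
    simpa using (he.2.contDiffAt (e.open_target.mem_nhds (e.map_source h0s))).hasStrictFDerivAt
      (by simp)
  have hc : HasStrictFDerivAt c ((fderiv ℝ e.symm (e 0)).comp ι) 0 :=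
    hsymm.comp (0 : ℝ × ℝ) (ι.hasStrictFDerivAt.const_add (e 0))
  have hinj : Function.Injective ((fderiv ℝ e.symm (e 0)).comp ι) := fun s t hst => by
    have h := congrArg (fderiv ℝ e 0) hst
    simp only [ContinuousLinearMap.comp_apply, he.fderiv_apply_fderiv_symm h0s] at h
    exact Prod.ext (congrFun h 0) (congrFun h 1)
  have hc0 : c 0 = 0 := by simp [c, h0s]
  filter_upwards [hc0 ▸ eventually_mem_range_of_realPlane hc hinj fun t => hbH (hcb t)]
    with p hp hpr
  obtain ⟨t, rfl⟩ := hp hpr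
  exact hcb t

theorem exists_real_equiv_comp_eq_imPart {L : (ℂ × ℂ) →L[ℝ] (ℝ × ℝ)}
    (hL : Function.Surjective L) (hreal : ∀ p ∈ realPlane, L p = 0) :
    ∃ Φ : (ℂ × ℂ) ≃L[ℂ] (ℂ × ℂ), (∀ p, Φ (conjC2 p) = conjC2 (Φ p)) ∧
      ∀ p, L (Φ p) = imPart p := by
  obtain ⟨X, hX⟩ := hL (1, 0)
  obtain ⟨Y, hY⟩ := hL (0, 1)
  let Φ : (ℂ × ℂ) →ₗ[ℂ] (ℂ × ℂ) :=
    (LinearMap.fst ℂ ℂ ℂ).smulRight ((X.1.im : ℂ), (X.2.im : ℂ)) +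
      (LinearMap.snd ℂ ℂ ℂ).smulRight ((Y.1.im : ℂ), (Y.2.im : ℂ))
  have hLΦ : ∀ p, L (Φ p) = imPart p := fun p => by
    have h := hreal (Φ p - (p.1.im • X + p.2.im • Y))
      ⟨by simp [Φ, mul_comm], by simp [Φ, mul_comm]⟩
    rw [map_sub, sub_eq_zero, map_add, map_smul, map_smul, hX, hY] at h
    simpa [imPart_apply] using h
  have hinj : Function.Injective Φ := by
    refine (injective_iff_map_eq_zero Φ).2 fun p hp => ?_
    have him : imPart p = 0 := by rw [← hLΦ, hp, map_zero]
    have hre : imPart (Complex.I • p) = 0 := by rw [← hLΦ, map_smul, hp, smul_zero, map_zero]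
    simp only [imPart_apply, Prod.smul_fst, Prod.smul_snd, smul_eq_mul, Complex.I_mul_im,
      Prod.mk_eq_zero] at him hre
    exact Prod.ext (Complex.ext hre.1 him.1) (Complex.ext hre.2 him.2)
  refine ⟨(LinearEquiv.ofInjectiveEndo Φ hinj).toContinuousLinearEquiv, fun p => ?_, hLΦ⟩
  change Φ (conjC2 p) = conjC2 (Φ p)
  simp [Φ, conjC2]

theorem fderiv_eq_zero_of_mem_realPlane {F : Type*} [NormedAddCommGroup F] [NormedSpace ℝ F]
    {h : ℂ × ℂ → F} (hd : DifferentiableAt ℝ h 0)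
    (h0 : ∀ᶠ p in 𝓝 (0 : ℂ × ℂ), p ∈ realPlane → h p = 0) {v : ℂ × ℂ} (hv : v ∈ realPlane) :
    fderiv ℝ h 0 v = 0 := by
  refine fderiv_eq_zero_of_mem_tangentVectors (S := realPlane) ⟨fun t => t • v, ?_, zero_smul ℝ v,
    Filter.Eventually.of_forall fun t => ⟨by simp [hv.1], by simp [hv.2]⟩, ?_⟩ hd h0
  · exact contDiffAt_id.smul contDiffAt_const
  · simpa using ((hasDerivAt_id (0 : ℝ)).smul_const v).deriv

theorem IsSmoothHypersurfaceWithBoundary.exists_real_equiv_isHalfGraph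
    (hH : IsSmoothHypersurfaceWithBoundary H bH) (h0 : (0 : ℂ × ℂ) ∈ bH) (hbH : bH ⊆ realPlane) :
    ∃ Φ : (ℂ × ℂ) ≃L[ℂ] (ℂ × ℂ), (∀ p, Φ (conjC2 p) = conjC2 (Φ p)) ∧
      ∃ r : ℂ × ℝ → ℝ, ContDiff ℝ ∞ r ∧ (∀ᶠ q in 𝓝 (0 : ℂ × ℝ), q.1.im = 0 → r q = 0) ∧
        IsHalfGraph (Φ ⁻¹' H) r := by
  obtain ⟨e, he, h0s, -, heH, heb⟩ := hH.boundary_chart 0 h0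
  have hsmooth : ContDiffOn ℝ ∞ (boundaryCoords ∘ e) e.source :=
    boundaryCoords.contDiff.comp_contDiffOn he.1
  have hvanish : ∀ᶠ p in 𝓝 (0 : ℂ × ℂ), p ∈ realPlane → (boundaryCoords ∘ e) p = 0 := by
    filter_upwards [eventually_mem_of_subset_realPlane he h0s h0 hbH heb,
      e.open_source.mem_nhds h0s] with p hp hps hpr
    exact Prod.mk_eq_zero.2 ((mem_iff_of_image_inter_eq e.injOn heb hps).1 (hp hpr))
  have hd := (he.1.contDiffAt (e.open_source.mem_nhds h0s)).differentiableAt (by simp)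
  have hD : HasFDerivAt (boundaryCoords ∘ e) (boundaryCoords.comp (fderiv ℝ e 0)) 0 :=
    boundaryCoords.hasFDerivAt.comp 0 hd.hasFDerivAt
  have hsurj : Function.Surjective (boundaryCoords.comp (fderiv ℝ e 0)) := fun t =>
    ⟨fderiv ℝ e.symm (e 0) ![0, 0, t.1, t.2], by
      rw [ContinuousLinearMap.comp_apply, he.fderiv_apply_fderiv_symm h0s]
      rfl⟩
  obtain ⟨Φ, hΦ, hLΦ⟩ := exists_real_equiv_comp_eq_imPart hsurj fun v hv =>
    hD.fderiv ▸ fderiv_eq_zero_of_mem_realPlane hD.differentiableAt hvanish hv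
  have hΦ0 : Filter.Tendsto Φ (𝓝 0) (𝓝 0) := by simpa using Φ.continuous.tendsto 0
  have hDΦ : HasFDerivAt (boundaryCoords ∘ e ∘ Φ) imPart 0 := by
    rw [← map_zero Φ] at hD
    exact (hD.comp (0 : ℂ × ℂ) (Φ.restrictScalars ℝ).hasFDerivAt).congr_fderiv
      (ContinuousLinearMap.ext fun p => by simpa using hLΦ p)
  obtain ⟨r, hr, hr0, hgraph⟩ := exists_isHalfGraph (σ := boundaryCoords ∘ e ∘ Φ)
    (hsmooth.comp (Φ.restrictScalars ℝ).contDiff.contDiffOn (Set.mapsTo_preimage Φ _))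
    (e.open_source.preimage Φ.continuous) (by simpa using h0s) hDΦ
    ((hΦ0.eventually hvanish).mono fun p hp hpr => hp ((map_mem_realPlane_iff hΦ).2 hpr))
  refine ⟨Φ, hΦ, r, hr, hr0, ?_⟩
  filter_upwards [hgraph, hΦ0.eventually (e.open_source.mem_nhds h0s)] with p hp hps
  exact (mem_iff_of_image_inter_eq e.injOn heH hps).trans hp

end BoundaryCoordinates

theorem theorem3p1 (H bH : Set (ℂ × ℂ))
    (hH : IsSmoothHypersurfaceWithBoundary H bH)
    (hflat : IsLeviFlat (H \ bH))
    (h0 : (0 : ℂ × ℂ) ∈ bH)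
    (hbH : bH ⊆ realPlane) :
    ∃ U : Set (ℂ × ℂ), IsOpen U ∧ (0 : ℂ × ℂ) ∈ U ∧ U = conjC2 '' U ∧
      IsSmoothHypersurface ((H ∩ U) ∪ conjC2 '' (H ∩ U)) ∧
      IsLeviFlat ((H ∩ U) ∪ conjC2 '' (H ∩ U)) := by
  obtain ⟨Φ, hΦ, r, hr, hr0, hgraph⟩ := hH.exists_real_equiv_isHalfGraph h0 hbH
  have hreal : Φ ⁻¹' bH ⊆ realPlane := fun p hp => (map_mem_realPlane_iff hΦ).1 (hbH hp)
  have hreflect := hgraph.hasLeviFlatReflection hr hr0 hreal (hflat.preimage Φ)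
  have hsymm : ∀ p, Φ.symm (conjC2 p) = conjC2 (Φ.symm p) := fun p => by
    rw [Φ.symm_apply_eq, hΦ, Φ.apply_symm_apply]
  have h := hreflect.preimage Φ.symm hsymm
  rwa [← Set.preimage_comp, Φ.self_comp_symm, Set.preimage_id] at h
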